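/- All logarithms are to base $2$. A depth-$d$ circuit of size $s$ has at most $s$ AND and OR gates of unbounded fan-in, with at most $d$ gates on any path from an input to the output; negations are free. For Boolean functions $h_1,\dots,h_m:\{0,1\}^n\to\{0,1\}$ (help functions), $H=\{h_1,\dots,h_m\}$, let $\mathrm{SizeDepth}_H(s,d)$ be the set of functions $f:\{0,1\}^n\to\{0,1\}$ of the form $f(x)=C(h_1(x),\dots,h_m(x))$, where $C$ is a circuit of size at most $s$ and depth at most $d$. Let $d\in\mathbb N$ and let $c_0>c_1>c_2>0$ be real constants with $c_0>(c_1+2c_2)d+c_2$. For $n\ge 1$ put $N=2^n$, $k=2^{(\log n)^{c_0}}$ and $r=N/2^{(\log n)^{c_1}}$. Suppose that the Remote Point Problem with parameters $(N,k,r)$ is solvable in time $2^{n^{O(1)}}$; that is, there is a deterministic algorithm with this running time which, given $n$ and at most $k$ vectors spanning a subspace $V\subseteq\mathbb F_2^N$, finds a vector $v\in\mathbb F_2^N$ at Hamming distance at least $r$ from every $u\in V$, whenever such a vector exists. Then for any given set of at most $2^{(\log n)^{c_2}}$ help functions there is an explicit Boolean function outside $\mathrm{SizeDepth}_H(cn^c,d)$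 for large $n$. Precisely: there are functions $g_{n,H}:\{0,1\}^n\to\{0,1\}$, one for each $n$ and each finite sequence $H=(h_1,\dots,h_m)$ of help functions on $\{0,1\}^n$, such that 1. a single deterministic algorithm computes $g_{n,H}(x)$ in time $2^{n^{O(1)}}$ from $x\in\{0,1\}^n$ and the truth tables of $h_1,\dots,h_m$, for all $n\ge1$, all $H$ with $m\le 2^{(\log n)^{c_2}}$ and all $x$; 2. for every $c\in\mathbb N$ and all sufficiently large $n$ (depending on $c$ but not on $H$), $g_{n,H}\notin\mathrm{SizeDepth}_H(cn^c,d)$ for every $H$ with $m\le 2^{(\log n)^{c_2}}$. -/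

import Mathlib

open Filter

/-! ## Computations with a step count

Algorithms are structured programs for a machine with finitely many stacks of bits, that is, a
deterministic multitape machine (a stack is a half-tape). A program mentions finitely many stacks,
and every instruction and every test acts on the top of one stack and costs one step. -/

/-- The programs; stacks are named by natural numbers. -/
inductive StackProg : Type
  /-- do nothing -/
  | skip : StackProg
  /-- push the bit `b` on stack `x` -/
  | push (x : ℕ) (b : Bool) : StackProg
  /-- remove the top of stack `x` (no effect if the stack is empty) -/
  | pop (x : ℕ) : StackProg
  /-- run `p`, then `q` -/
  | seq (p q : StackProg) : StackProg
  /-- run `p`, `q` or `r` if stack `x` is empty, has top `false` or has top `true` -/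
  | branch (x : ℕ) (p q r : StackProg) : StackProg
  /-- run `p` as long as stack `x` is nonempty -/
  | loop (x : ℕ) (p : StackProg) : StackProg

namespace StackProg

/-- Contents of all the stacks; the head of a list is the top of the stack. -/
abbrev Store : Type := ℕ → List Bool

/-- `Runs p σ t τ`: started in `σ`, the program `p` halts after exactly `t` steps in `τ`. -/
inductive Runs : StackProg → Store → ℕ → Store → Prop
  | skip (σ : Store) : Runs .skip σ 1 σ
  | push (σ : Store) (x : ℕ) (b : Bool) :
      Runs (.push x b) σ 1 (Function.update σ x (b :: σ x))
  | pop (σ : Store) (x : ℕ) : Runs (.pop x) σ 1 (Function.update σ x (σ x).tail)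
  | seq {p q : StackProg} {σ τ υ : Store} {t u : ℕ} :
      Runs p σ t τ → Runs q τ u υ → Runs (.seq p q) σ (t + u) υ
  | branch_nil {x : ℕ} {p q r : StackProg} {σ τ : Store} {t : ℕ} :
      σ x = [] → Runs p σ t τ → Runs (.branch x p q r) σ (t + 1) τ
  | branch_false {x : ℕ} {p q r : StackProg} {σ τ : Store} {t : ℕ} {l : List Bool} :
      σ x = false :: l → Runs q σ t τ → Runs (.branch x p q r) σ (t + 1) τ
  | branch_true {x : ℕ} {p q r : StackProg} {σ τ : Store} {t : ℕ} {l : List Bool} :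
      σ x = true :: l → Runs r σ t τ → Runs (.branch x p q r) σ (t + 1) τ
  | loop_done {x : ℕ} {p : StackProg} {σ : Store} :
      σ x = [] → Runs (.loop x p) σ 1 σ
  | loop_step {x : ℕ} {p : StackProg} {σ τ υ : Store} {t u : ℕ} :
      σ x ≠ [] → Runs p σ t τ → Runs (.loop x p) τ u υ → Runs (.loop x p) σ (t + u + 1) υ

/-- The initial store: the input strings are on stacks `0, 1, …`, all other stacks are empty. -/
def load (inputs : List (List Bool)) : Store := fun i => inputs.getD i []

/-- On the given input strings, `p` halts within `T` steps with `out` on stack `0`. -/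
def OutputsWithin (p : StackProg) (inputs : List (List Bool)) (out : List Bool) (T : ℕ) : Prop :=
  ∃ t ≤ T, ∃ τ : Store, Runs p (load inputs) t τ ∧ τ 0 = out

end StackProg

/-! ## Boolean functions and circuits -/

/-- Boolean functions `{0,1}ⁿ → {0,1}`. -/
abbrev BoolFn (n : ℕ) : Type := (Fin n → Bool) → Bool

/-- The truth table, a string of length `2 ^ n`: its entry number `i` is the value of `f` at the
point whose coordinates are the `n` binary digits of `i`. -/
def BoolFn.truthTable {n : ℕ} (f : BoolFn n) : List Bool :=
  List.ofFn fun i : Fin (2 ^ n) => f fun j : Fin n => (i : ℕ).testBit j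

/-- Circuits with `m` inputs and `s` gates (AND and OR gates of unbounded fan-in), listed in
topological order. The second component of an argument says whether it is negated. -/
inductive Circuit (m : ℕ) : ℕ → Type
  | nil : Circuit m 0
  | and {s : ℕ} (C : Circuit m s) (args : Finset ((Fin m ⊕ Fin s) × Bool)) : Circuit m (s + 1)
  | or {s : ℕ} (C : Circuit m s) (args : Finset ((Fin m ⊕ Fin s) × Bool)) : Circuit m (s + 1)

namespace Circuit

variable {m : ℕ}

/-- The value of each gate on input `y`. The empty AND is true, the empty OR is false. -/
def gateValue (y : Fin m → Bool) : {s : ℕ} → Circuit m s → Fin s → Bool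
  | _, .nil => Fin.elim0
  | _, .and C args => Fin.snoc (α := fun _ => Bool) (gateValue y C)
      (decide (∀ a ∈ args, xor (Sum.elim y (gateValue y C) a.1) a.2 = true))
  | _, .or C args => Fin.snoc (α := fun _ => Bool) (gateValue y C)
      (decide (∃ a ∈ args, xor (Sum.elim y (gateValue y C) a.1) a.2 = true))

/-- The depth of each gate: the largest number of gates on a directed path ending there
(inputs have depth `0`, negations are not counted). -/
def gateDepth : {s : ℕ} → Circuit m s → Fin s → ℕ
  | _, .nil => Fin.elim0
  | _, .and C args => Fin.snoc (α := fun _ => ℕ) (gateDepth C)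
      (args.sup (fun a => Sum.elim (fun _ => 0) (gateDepth C) a.1) + 1)
  | _, .or C args => Fin.snoc (α := fun _ => ℕ) (gateDepth C)
      (args.sup (fun a => Sum.elim (fun _ => 0) (gateDepth C) a.1) + 1)

/-- The value of the possibly negated node `o`. -/
def value {s : ℕ} (C : Circuit m s) (o : (Fin m ⊕ Fin s) × Bool) (y : Fin m → Bool) : Bool :=
  xor (Sum.elim y (C.gateValue y) o.1) o.2

/-- The depth of the possibly negated node `o`. -/
def depth {s : ℕ} (C : Circuit m s) (o : (Fin m ⊕ Fin s) × Bool) : ℕ :=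
  Sum.elim (fun _ => 0) C.gateDepth o.1

end Circuit

/-- `SizeDepth h s d`: the Boolean functions `f(x) = C(h₁(x), …, h_m(x))`, where `C` is a circuit
with at most `s` gates and depth at most `d`. -/
def SizeDepth {n m : ℕ} (h : Fin m → BoolFn n) (s d : ℕ) : Set (BoolFn n) :=
  {f | ∃ t ≤ s, ∃ (C : Circuit m t) (o : (Fin m ⊕ Fin t) × Bool),
    C.depth o ≤ d ∧ ∀ x, f x = C.value o fun i => h i x}

/-- `g` assigns a Boolean function to any family `h` of `m` help functions on `{0,1}ⁿ` with
`m ≤ M n`. It is explicit if a single program, on input `x ∈ {0,1}ⁿ` and the truth tables of the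
help functions, computes `g h x` in time `2^(n^O(1))`. -/
def ExplicitGivenHelp (M : ℕ → ℝ) (g : (n m : ℕ) → (Fin m → BoolFn n) → BoolFn n) : Prop :=
  ∃ (p : StackProg) (a : ℕ), ∀ n : ℕ, 0 < n → ∀ m : ℕ, (m : ℝ) ≤ M n →
    ∀ (h : Fin m → BoolFn n) (x : Fin n → Bool),
      p.OutputsWithin [List.ofFn x, (List.ofFn fun i => (h i).truthTable).flatten]
        [g n m h x] (2 ^ (a * n ^ a + a))

/-! ## The Remote Point Problem in the Hamming metric -/

/-- `v` has Hamming distance at least `r` from every point of `V`. -/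
def IsRemote {N : ℕ} (V : Submodule (ZMod 2) (Fin N → ZMod 2)) (r : ℝ) (v : Fin N → ZMod 2) :
    Prop :=
  ∀ u ∈ V, r ≤ hammingDist u v

/-- A vector over `𝔽₂` as a bit string. -/
def vecBits {N : ℕ} (v : Fin N → ZMod 2) : List Bool :=
  List.ofFn fun i => decide (v i = 1)

/-- The Remote Point Problem with parameters `(N, k, r) = (2 ^ n, k n, r n)` is solvable in time
`2^(n^O(1))`: a single program, given `n` in unary and at most `k n` vectors that span a subspace
`V` of `𝔽₂^N`, finds a point at distance at least `r n` from `V` if there is one. -/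
def RemotePointSolvable (k r : ℕ → ℝ) : Prop :=
  ∃ (p : StackProg) (a : ℕ), ∀ n : ℕ, 0 < n → ∀ m : ℕ, (m : ℝ) ≤ k n →
    ∀ w : Fin m → Fin (2 ^ n) → ZMod 2,
      (∃ v, IsRemote (Submodule.span (ZMod 2) (Set.range w)) (r n) v) →
      ∃ v, IsRemote (Submodule.span (ZMod 2) (Set.range w)) (r n) v ∧
        p.OutputsWithin [List.replicate n true, (List.ofFn fun i => vecBits (w i)).flatten]
          (vecBits v) (2 ^ (a * n ^ a + a))

/-!
If `c₂ < 1`, there are fewer than `n` help functions for large `n`. By pigeonhole two points of the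
cube have the same values of all help functions, so a function that separates points with the same
values is outside `SizeDepth`. The function `firstInAtomFn` marks the first point of each class, and
it is computed from the tables by brute force; the algorithm for the Remote Point Problem plays no
role.

If `1 ≤ c₂`, then `1 < c₁`. By Razborov's method (`Circuit.exists_approx`), a function in
`SizeDepth h s d` agrees with a polynomial over `𝔽₂` of degree at most `l ^ d` in the help
functions, except at a fraction `s * 2 ^ (-l)` of the points: an OR of functions is replaced by a
polynomial of degree `l` in them, and iterated averaging makes the one-sided error `2 ^ (-l)`. For
`l` about `3 (log n) ^ c₁` the error is less than `2 ^ (-(log n) ^ c₁)` when `s` is polynomial in `n`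
(`eventually_exists_degree`; this uses `1 < c₁`). As `2 * c₂ ≥ 2`, there is a natural number `e` with
`c₁ * d < e` (or `d = 0`) and `e + c₂ < c₀`. With `L` the number of binary digits of `n`, the
products of `L ^ e` factors from `1` and the help functions span all the polynomials in question, and
their number `(m + 1) ^ (L ^ e)` is at most `2 ^ (log n) ^ c₀` (`eventually_succ_pow_le`). A vector
remote from their span exists by counting (`exists_isRemote`), hence is found by the given algorithm,
and it is the table of a function outside `SizeDepth` (`not_mem_sizeDepth_of_isRemote`).

The exponent `e` is an integer, so that the number of factors is computed without real arithmetic,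
and the finitely many `n` for which the estimates fail are caught by a test in the program. The
running times are tracked by `StackProg.Does`, which measures them as powers of a bound `Q` for the
lengths of all strings; `Runs.shift` runs the given algorithm on stacks that the rest of the program
does not touch.
-/

/-! ### Low-degree approximation of bounded-depth circuits -/

/-- A bit as an element of `𝔽₂`. -/
def bitToZMod (b : Bool) : ZMod 2 := if b then 1 else 0

lemma ZMod.eq_one_of_ne_zero_two {a : ZMod 2} (h : a ≠ 0) : a = 1 := by
  revert a; decide

@[simp] lemma bitToZMod_eq_zero {b : Bool} : bitToZMod b = 0 ↔ b = false := by
  cases b <;> simp [bitToZMod]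

@[simp] lemma bitToZMod_eq_one {b : Bool} : bitToZMod b = 1 ↔ b = true := by
  cases b <;> simp [bitToZMod]

lemma bitToZMod_xor (a b : Bool) : bitToZMod (xor a b) = bitToZMod a + bitToZMod b := by
  revert a b; decide

/-- A random `𝔽₂`-combination of the `q a` vanishes at a point where some `q a` does not with
probability `1/2`; hence some combination vanishes on at most half of `E`. -/
lemma exists_combination_vanishing_on_half {ι X : Type*} [Fintype ι] [DecidableEq ι]
    (A : Finset ι) (q : ι → X → ZMod 2) (E : Finset X)
    (hE : ∀ x ∈ E, ∃ a ∈ A, q a x ≠ 0) :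
    ∃ c : ι → ZMod 2, 2 * (E.filter fun x => ∑ a ∈ A, c a * q a x = 0).card ≤ E.card := by
  classical
  have hhalf : ∀ x ∈ E, 2 * (Finset.univ.filter fun c : ι → ZMod 2 =>
      ∑ a ∈ A, c a * q a x = 0).card ≤ Fintype.card (ι → ZMod 2) := by
    intro x hx
    obtain ⟨a₀, ha₀, hne⟩ := hE x hx
    have hle : (Finset.univ.filter fun c : ι → ZMod 2 => ∑ a ∈ A, c a * q a x = 0).card ≤
        (Finset.univ.filter fun c : ι → ZMod 2 => ¬ ∑ a ∈ A, c a * q a x = 0).card := by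
      refine Finset.card_le_card_of_injOn (fun c => c + Pi.single a₀ 1) ?_ ?_
      · intro c hc
        have hc' : ∑ a ∈ A, c a * q a x = 0 := by simpa using hc
        have : ∑ a ∈ A, (c + Pi.single a₀ 1 : ι → ZMod 2) a * q a x = q a₀ x := by
          simp [add_mul, Finset.sum_add_distrib, hc', Pi.single_apply, ha₀]
        simpa only [Finset.coe_filter, Finset.mem_univ, true_and, Set.mem_ofPred_eq, this] using hne
      · intro c _ c' _ h
        exact add_right_cancel h
    have hsum := Finset.card_filter_add_card_filter_not (s := (Finset.univ : Finset (ι → ZMod 2)))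
      (fun c => ∑ a ∈ A, c a * q a x = 0)
    rw [Finset.card_univ] at hsum
    omega
  by_contra hcon
  push Not at hcon
  have h1 : ∑ c : ι → ZMod 2, 2 * (E.filter fun x => ∑ a ∈ A, c a * q a x = 0).card =
      ∑ x ∈ E, 2 * (Finset.univ.filter fun c : ι → ZMod 2 => ∑ a ∈ A, c a * q a x = 0).card := by
    simp only [Finset.card_filter, Finset.mul_sum]
    exact Finset.sum_comm
  have h2 : ∑ c : ι → ZMod 2, E.card <
      ∑ c : ι → ZMod 2, 2 * (E.filter fun x => ∑ a ∈ A, c a * q a x = 0).card :=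
    Finset.sum_lt_sum_of_nonempty Finset.univ_nonempty fun c _ => hcon c
  have h3 := Finset.sum_le_sum hhalf
  simp only [Finset.sum_const, smul_eq_mul, Finset.card_univ] at h2 h3
  rw [h1] at h2
  have h4 := mul_comm E.card (Fintype.card (ι → ZMod 2))
  omega

/-- Razborov's approximation of a NOR of the `q a` by a product of `l` affine combinations of
them. The error is one-sided. -/
lemma exists_nor_approx {ι X : Type*} [Fintype ι] [Fintype X]
    (A : Finset ι) (q : ι → X → ZMod 2) (P : Submodule (ZMod 2) (X → ZMod 2))
    (h1 : (1 : X → ZMod 2) ∈ P) (hq : ∀ a ∈ A, q a ∈ P) (l : ℕ) :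
    ∃ p ∈ P ^ l, (∀ x, (∀ a ∈ A, q a x = 0) → p x = 1) ∧
      (Finset.univ.filter fun x => (∃ a ∈ A, q a x ≠ 0) ∧ p x ≠ 0).card * 2 ^ l ≤
        Fintype.card X := by
  classical
  induction l with
  | zero =>
    refine ⟨1, by rw [pow_zero]; exact Submodule.one_le.1 le_rfl, fun _ _ => rfl, ?_⟩
    simpa only [pow_zero, mul_one] using Finset.card_le_univ _
  | succ l ih =>
    obtain ⟨p, hp, hp1, hcard⟩ := ih
    obtain ⟨c, hc⟩ := exists_combination_vanishing_on_half A q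
      (Finset.univ.filter fun x => (∃ a ∈ A, q a x ≠ 0) ∧ p x ≠ 0)
      (fun x hx => (Finset.mem_filter.1 hx).2.1)
    refine ⟨p * (1 - ∑ a ∈ A, c a • q a), ?_, ?_, ?_⟩
    · rw [pow_succ]
      exact Submodule.mul_mem_mul hp
        (P.sub_mem h1 (P.sum_mem fun a ha => P.smul_mem _ (hq a ha)))
    · intro x hx
      have : ∑ a ∈ A, c a * q a x = 0 := Finset.sum_eq_zero fun a ha => by rw [hx a ha, mul_zero]
      simp [hp1 x hx, this]
    · have hsub : (Finset.univ.filter fun x =>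
          (∃ a ∈ A, q a x ≠ 0) ∧ (p * (1 - ∑ a ∈ A, c a • q a)) x ≠ 0) ⊆
          ((Finset.univ.filter fun x => (∃ a ∈ A, q a x ≠ 0) ∧ p x ≠ 0).filter
            fun x => ∑ a ∈ A, c a * q a x = 0) := by
        intro x hx
        simp only [Finset.mem_filter, Finset.mem_univ, true_and, Pi.mul_apply, Pi.sub_apply,
          Pi.one_apply, Finset.sum_apply, Pi.smul_apply, smul_eq_mul] at hx ⊢
        refine ⟨⟨hx.1, left_ne_zero_of_mul hx.2⟩, ?_⟩
        by_contra hne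
        exact hx.2 (by rw [ZMod.eq_one_of_ne_zero_two hne, sub_self, mul_zero])
      have := Finset.card_le_card hsub
      calc _ ≤ _ * 2 ^ (l + 1) := Nat.mul_le_mul_right _ this
        _ = (2 * _) * 2 ^ l := by rw [pow_succ]; ring
        _ ≤ _ := (Nat.mul_le_mul_right _ hc).trans hcard

/-- The span of `1` and the functions `h i`; its `k`-th power consists of the polynomials of degree
at most `k` in the `h i`. -/
def helpSpan {m : ℕ} {X : Type*} (h : Fin m → X → Bool) :
    Submodule (ZMod 2) (X → ZMod 2) :=
  Submodule.span (ZMod 2) (insert 1 (Set.range fun i x => bitToZMod (h i x)))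

section helpSpan

variable {m : ℕ} {X : Type*} (h : Fin m → X → Bool)

lemma one_mem_helpSpan : (1 : X → ZMod 2) ∈ helpSpan h :=
  Submodule.subset_span (Set.mem_insert _ _)

lemma bit_mem_helpSpan (i : Fin m) : (fun x => bitToZMod (h i x)) ∈ helpSpan h :=
  Submodule.subset_span (Set.mem_insert_of_mem _ ⟨i, rfl⟩)

lemma helpSpan_pow_mono {a b : ℕ} (hab : a ≤ b) : helpSpan h ^ a ≤ helpSpan h ^ b :=
  pow_le_pow_right₀ (Submodule.one_le.2 (one_mem_helpSpan h)) hab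

lemma one_mem_helpSpan_pow (k : ℕ) : (1 : X → ZMod 2) ∈ helpSpan h ^ k :=
  helpSpan_pow_mono h (Nat.zero_le k) (by rw [pow_zero]; exact Submodule.one_le.1 le_rfl)

lemma add_bit_mem_helpSpan_pow {k : ℕ} {q : X → ZMod 2} (hq : q ∈ helpSpan h ^ k) (b : Bool) :
    (fun x => q x + bitToZMod b) ∈ helpSpan h ^ k := by
  cases b
  · simpa [bitToZMod] using hq
  · exact Submodule.add_mem _ hq (one_mem_helpSpan_pow h k)

/-- One gate: from functions `q` of degree at most `l ^ k` that agree with the arguments `v` outside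
the exceptional set `B`, the approximation of their NOR has degree at most `l ^ (k + 1)` and errs
outside `B` on at most a fraction `2 ^ (-l)` of the points. -/
lemma exists_gate_approx [Fintype X] {ι : Type*} [Fintype ι] (A : Finset ι)
    (v : ι → X → Bool) (q : ι → X → ZMod 2) (l k : ℕ) (hq : ∀ a ∈ A, q a ∈ helpSpan h ^ l ^ k)
    (B : Finset X) (hB : ∀ x ∉ B, ∀ a ∈ A, q a x = bitToZMod (v a x)) :
    ∃ p ∈ helpSpan h ^ l ^ (k + 1), ∃ B' : Finset X, B'.card * 2 ^ l ≤ Fintype.card X ∧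
      ∀ x ∉ B, x ∉ B' → 
        ∀ b : Bool, (b = true ↔ ∀ a ∈ A, v a x = false) → p x = bitToZMod b := by
  classical
  obtain ⟨p, hp, hp1, hcard⟩ := exists_nor_approx A q (helpSpan h ^ l ^ k)
    (one_mem_helpSpan_pow h _) hq l
  refine ⟨p, by rwa [pow_succ, pow_mul], _, hcard, ?_⟩
  intro x hx hx' b hb
  by_cases hall : ∀ a ∈ A, v a x = false
  · rw [hp1 x fun a ha => by rw [hB x hx a ha, hall a ha]; rfl, hb.2 hall]; rfl
  · have hne : ∃ a ∈ A, q a x ≠ 0 := by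
      push Not at hall
      obtain ⟨a, ha, hv⟩ := hall
      exact ⟨a, ha, by rw [hB x hx a ha]; simpa using hv⟩
    have h0 : p x = 0 := by
      by_contra h0
      exact hx' (Finset.mem_filter.2 ⟨Finset.mem_univ x, hne, h0⟩)
    rw [h0, Bool.eq_false_iff.2 fun h => hall (hb.1 h)]; rfl

/-- All gates of a circuit with `s` gates over the inputs `h` are simultaneously approximated by
polynomials of degree `l ^ depth`, outside a set of at most `s * 2 ^ (-l) * |X|` points. -/
lemma Circuit.exists_gates_approx [Fintype X] {l : ℕ} (hl : 0 < l) {s : ℕ} (C : Circuit m s) :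
    ∃ (q : Fin s → X → ZMod 2) (B : Finset X), (∀ j, q j ∈ helpSpan h ^ l ^ C.gateDepth j) ∧
      B.card * 2 ^ l ≤ s * Fintype.card X ∧
      ∀ x ∉ B, ∀ j, q j x = bitToZMod (C.gateValue (fun i => h i x) j) := by
  classical
  -- Both kinds of gates are a NOR of possibly negated nodes, up to a negation of the result.
  have key : ∀ {s : ℕ} (C : Circuit m s) (args : Finset ((Fin m ⊕ Fin s) × Bool)) (neg : Bool)
      (q : Fin s → X → ZMod 2) (B : Finset X), (∀ j, q j ∈ helpSpan h ^ l ^ C.gateDepth j) →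
      B.card * 2 ^ l ≤ s * Fintype.card X →
      (∀ x ∉ B, ∀ j, q j x = bitToZMod (C.gateValue (fun i => h i x) j)) →
      ∃ p ∈ helpSpan h ^ l ^
          (args.sup (fun a => Sum.elim (fun _ => 0) C.gateDepth a.1) + 1), ∃ B'' : Finset X,
        B''.card * 2 ^ l ≤ (s + 1) * Fintype.card X ∧ B ⊆ B'' ∧
        ∀ x ∉ B'', ∀ b : Bool, (b = true ↔ ∀ a ∈ args,
          xor (xor (Sum.elim (fun i => h i x) (C.gateValue fun i => h i x) a.1) a.2) neg
            = false) → p x = bitToZMod b := by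
    intro s C args neg q B hq hB hval
    obtain ⟨p, hp, B', hB', hp'⟩ := exists_gate_approx h args
      (fun a x => xor (xor (Sum.elim (fun i => h i x) (C.gateValue fun i => h i x) a.1) a.2) neg)
      (fun a x => (Sum.elim (fun i => bitToZMod (h i x)) (fun j => q j x) a.1 + bitToZMod a.2) +
        bitToZMod neg)
      l (args.sup (fun a => Sum.elim (fun _ => 0) C.gateDepth a.1)) (by
        rintro ⟨a, b⟩ ha
        refine add_bit_mem_helpSpan_pow h (add_bit_mem_helpSpan_pow h ?_ b) neg
        refine helpSpan_pow_mono h (Nat.pow_le_pow_right hl (Finset.le_sup ha)) ?_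
        rcases a with i | j
        · simpa using bit_mem_helpSpan h i
        · exact hq j) B (by
        rintro x hx ⟨a, b⟩ -
        rw [bitToZMod_xor, bitToZMod_xor]
        rcases a with i | j
        · rfl
        · simp [hval x hx j])
    refine ⟨p, hp, B ∪ B', ?_, Finset.subset_union_left, fun x hx => ?_⟩
    · calc _ ≤ (B.card + B'.card) * 2 ^ l := Nat.mul_le_mul_right _ (Finset.card_union_le _ _)
        _ = B.card * 2 ^ l + B'.card * 2 ^ l := by ring
        _ ≤ s * Fintype.card X + Fintype.card X := Nat.add_le_add hB hB'
        _ = _ := by ring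
    · rw [Finset.mem_union, not_or] at hx
      exact hp' x hx.1 hx.2
  induction C with
  | nil => exact ⟨Fin.elim0, ∅, fun j => j.elim0, by simp, fun _ _ j => j.elim0⟩
  | @and s C args ih =>
    obtain ⟨q, B, hq, hB, hval⟩ := ih
    obtain ⟨p, hp, B'', hB'', hsub, hp'⟩ := key C args true q B hq hB hval
    refine ⟨Fin.snoc (α := fun _ => X → ZMod 2) q p, B'', ?_, hB'', ?_⟩
    · intro j
      refine Fin.lastCases ?_ (fun j => ?_) j
      · simpa [Circuit.gateDepth] using hp
      · simpa [Circuit.gateDepth] using hq j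
    · intro x hx j
      refine Fin.lastCases ?_ (fun j => ?_) j
      · simp only [Circuit.gateValue, Fin.snoc_last]
        exact hp' x hx _ (by simp)
      · simpa [Circuit.gateValue] using hval x (fun h => hx (hsub h)) j
  | @or s C args ih =>
    obtain ⟨q, B, hq, hB, hval⟩ := ih
    obtain ⟨p, hp, B'', hB'', hsub, hp'⟩ := key C args false q B hq hB hval
    refine ⟨Fin.snoc (α := fun _ => X → ZMod 2) q (fun x => p x + bitToZMod true), B'', ?_, hB'',
      ?_⟩
    · intro j
      refine Fin.lastCases ?_ (fun j => ?_) j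
      · simpa [Circuit.gateDepth] using add_bit_mem_helpSpan_pow h hp true
      · simpa [Circuit.gateDepth] using hq j
    · intro x hx j
      refine Fin.lastCases ?_ (fun j => ?_) j
      · simp only [Circuit.gateValue, Fin.snoc_last]
        rw [hp' x hx (decide (∀ a ∈ args, xor (xor (Sum.elim (fun i => h i x)
          (C.gateValue fun i => h i x) a.1) a.2) false = false)) (by simp), ← bitToZMod_xor]
        congr 1
        rw [Bool.eq_iff_iff, Bool.xor_true, Bool.not_eq_true', decide_eq_false_iff_not,
          decide_eq_true_iff]
        push Not
        simp only [Bool.xor_false, ne_eq, Bool.not_eq_false]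
      · simpa [Circuit.gateValue] using hval x (fun h => hx (hsub h)) j

/-- A circuit of depth at most `d` with `s` gates agrees with a polynomial of degree at most `l ^ d`
in its inputs, outside a set of at most `s * 2 ^ (-l) * |X|` points. -/
lemma Circuit.exists_approx [Fintype X] {l : ℕ} (hl : 0 < l) {s d : ℕ} (C : Circuit m s)
    (o : (Fin m ⊕ Fin s) × Bool) (hd : C.depth o ≤ d) :
    ∃ q ∈ helpSpan h ^ l ^ d, ∃ B : Finset X, B.card * 2 ^ l ≤ s * Fintype.card X ∧
      ∀ x ∉ B, q x = bitToZMod (C.value o fun i => h i x) := by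
  obtain ⟨q, B, hq, hB, hval⟩ := C.exists_gates_approx h hl
  obtain ⟨a, b⟩ := o
  refine ⟨fun x => Sum.elim (fun i => bitToZMod (h i x)) (fun j => q j x) a + bitToZMod b,
    ?_, B, hB, fun x hx => ?_⟩
  · refine add_bit_mem_helpSpan_pow h ?_ b
    refine helpSpan_pow_mono h (Nat.pow_le_pow_right hl hd) ?_
    rcases a with i | j
    · simpa [Circuit.depth] using bit_mem_helpSpan h i
    · exact hq j
  · rw [Circuit.value, bitToZMod_xor]
    rcases a with i | j
    · rfl
    · simp [hval x hx j]

end helpSpan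

/-! ### Remote points exist -/

/-- Weighting a vector `v` at distance `δ` from `u` by `8 ^ (N - δ)` gives total weight `9 ^ N`. -/
lemma sum_prod_agreement {N : ℕ} (u : Fin N → ZMod 2) :
    ∑ v : Fin N → ZMod 2, ∏ i, (if u i ≠ v i then 1 else 8) = 9 ^ N := by
  have h : ∀ a : ZMod 2, ∑ b : ZMod 2, (if a ≠ b then 1 else 8) = 9 := by decide
  calc ∑ v : Fin N → ZMod 2, ∏ i, (if u i ≠ v i then 1 else 8)
      = ∏ i, ∑ b : ZMod 2, (if u i ≠ b then 1 else 8) := by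
        rw [Finset.prod_univ_sum, Fintype.piFinset_univ]
    _ = 9 ^ N := by simp only [h, Finset.prod_const, Finset.card_univ, Fintype.card_fin]

lemma pow_le_prod_agreement {N R : ℕ} {u v : Fin N → ZMod 2} (h : hammingDist u v ≤ R) :
    8 ^ (N - R) ≤ ∏ i, (if u i ≠ v i then 1 else 8) := by
  rw [Finset.prod_ite, Finset.prod_const_one, one_mul, Finset.prod_const]
  refine Nat.pow_le_pow_right (by norm_num) ?_
  have := Finset.card_filter_add_card_filter_not (s := (Finset.univ : Finset (Fin N)))
      (fun i => u i ≠ v i)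
  rw [Finset.card_univ, Fintype.card_fin] at this
  change (Finset.univ.filter fun i => u i ≠ v i).card ≤ R at h
  omega

/-- Counting: the balls of radius `N / 16` around a span of at most `N / 4` vectors do not cover
`𝔽₂ ^ N`. The ball volume is estimated by an exponential moment. -/
lemma exists_isRemote {N m : ℕ} (hN : 0 < N) (w : Fin m → Fin N → ZMod 2) {r : ℝ}
    (hm : 4 * m ≤ N) (hr : r ≤ N / 16) :
    ∃ v, IsRemote (Submodule.span (ZMod 2) (Set.range w)) r v := by
  by_contra hcon
  have hR : 16 * (N / 16) ≤ N := Nat.mul_div_le _ _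
  have hcover : ∀ v : Fin N → ZMod 2, ∃ c : Fin m → ZMod 2,
      hammingDist (∑ i, c i • w i) v ≤ N / 16 := by
    intro v
    have hv : ¬ IsRemote (Submodule.span (ZMod 2) (Set.range w)) r v := fun h => hcon ⟨v, h⟩
    simp only [IsRemote, not_forall, not_le] at hv
    obtain ⟨u, hu, hlt⟩ := hv
    obtain ⟨c, rfl⟩ := (Submodule.mem_span_range_iff_exists_fun _).1 hu
    refine ⟨c, ?_⟩
    rw [Nat.le_div_iff_mul_le (by norm_num)]
    have h1 : (hammingDist (∑ i, c i • w i) v : ℝ) * 16 ≤ N := by linarith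
    exact_mod_cast h1
  have h1 : ∑ v : Fin N → ZMod 2, 8 ^ (N - N / 16) ≤
      ∑ v : Fin N → ZMod 2, ∑ c : Fin m → ZMod 2,
        ∏ i, (if (∑ i, c i • w i) i ≠ v i then 1 else 8) := by
    refine Finset.sum_le_sum fun v _ => ?_
    obtain ⟨c, hc⟩ := hcover v
    exact (pow_le_prod_agreement hc).trans (Finset.single_le_sum
      (f := fun c : Fin m → ZMod 2 => ∏ i, (if (∑ i, c i • w i) i ≠ v i then 1 else 8))
      (fun _ _ => Nat.zero_le _) (Finset.mem_univ c))
  rw [Finset.sum_comm] at h1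
  simp only [sum_prod_agreement, Finset.sum_const, Finset.card_univ, Fintype.card_fun,
    Fintype.card_fin, ZMod.card, smul_eq_mul] at h1
  -- The sixteenth powers are compared, where both sides are bounded by powers of `2 ^ N`.
  have h2 : (2 ^ N * 8 ^ (N - N / 16)) ^ 16 ≤ (2 ^ m * 9 ^ N) ^ 16 := Nat.pow_le_pow_left h1 _
  have h3 : (2 ^ 61) ^ N ≤ (2 ^ N * 8 ^ (N - N / 16)) ^ 16 := by
    rw [show (8 : ℕ) = 2 ^ 3 by norm_num, ← pow_mul, ← pow_mul, ← pow_add, ← pow_mul]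
    exact Nat.pow_le_pow_right (by norm_num) (by omega)
  have h4 : (2 ^ m * 9 ^ N) ^ 16 ≤ (2 ^ 4 * 9 ^ 16) ^ N := by
    rw [mul_pow, mul_pow, ← pow_mul, ← pow_mul, ← pow_mul, ← pow_mul, mul_comm N 16]
    exact Nat.mul_le_mul_right _ (Nat.pow_le_pow_right (by norm_num) (by omega))
  have h5 : (2 ^ 4 * 9 ^ 16) ^ N < (2 ^ 61) ^ N :=
    Nat.pow_lt_pow_left (by norm_num) hN.ne'
  omega

/-! ### Products of help functions -/

/-- The list of all products of `k` factors from `1` and the members of `hs`. -/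
def productList {M : Type*} [Monoid M] (hs : List M) : ℕ → List M
  | 0 => [1]
  | k + 1 => productList hs k ++ hs.flatMap fun h => (productList hs k).map (h * ·)

lemma length_productList {M : Type*} [Monoid M] (hs : List M) (k : ℕ) :
    (productList hs k).length = (hs.length + 1) ^ k := by
  induction k with
  | zero => rfl
  | succ k ih => simp [productList, ih, List.length_flatMap]; ring

lemma helpSpan_pow_le_span_productList {m : ℕ} {X : Type*} (h : Fin m → X → Bool) (k : ℕ) :
    helpSpan h ^ k ≤ Submodule.span (ZMod 2)
      {q | q ∈ productList (List.ofFn fun i x => bitToZMod (h i x)) k} := by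
  induction k with
  | zero =>
    rw [pow_zero, Submodule.one_le]
    exact Submodule.subset_span (by simp [productList])
  | succ k ih =>
    rw [pow_succ', helpSpan]
    refine (mul_le_mul_right ih _).trans ?_
    rw [Submodule.span_mul_span, Submodule.span_le]
    rintro _ ⟨a, ha, b, hb, rfl⟩
    refine Submodule.subset_span ?_
    rcases ha with rfl | ⟨i, rfl⟩
    · simpa [productList] using Or.inl hb
    · simp only [productList, Set.mem_ofPred_eq, List.mem_append, List.mem_flatMap, List.mem_map]
      exact Or.inr ⟨_, List.mem_ofFn.2 ⟨i, rfl⟩, b, hb, rfl⟩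

/-! ### Points of the cube and positions in truth tables -/

/-- The point of the cube with the binary digits of `i` as coordinates. -/
def cubePoint (n i : ℕ) : Fin n → Bool := fun j => i.testBit j

/-- The position of a point in a truth table. -/
def cubeIndex {n : ℕ} (y : Fin n → Bool) : Fin (2 ^ n) := ⟨Nat.ofBits y, Nat.ofBits_lt_two_pow y⟩

@[simp] lemma cubePoint_cubeIndex {n : ℕ} (y : Fin n → Bool) : cubePoint n (cubeIndex y) = y := by
  funext j
  simp [cubePoint, cubeIndex, Nat.testBit_ofBits_lt]

lemma cubePoint_injective {n : ℕ} :
    Function.Injective fun i : Fin (2 ^ n) => cubePoint n i := by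
  intro a b h
  refine Fin.ext (Nat.eq_of_testBit_eq fun j => ?_)
  by_cases hj : j < n
  · exact congrFun h ⟨j, hj⟩
  · have hlt : ∀ c : Fin (2 ^ n), (c : ℕ).testBit j = false := fun c =>
      Nat.testBit_lt_two_pow (c.2.trans_le (Nat.pow_le_pow_right two_pos (not_lt.1 hj)))
    rw [hlt, hlt]

@[simp] lemma cubeIndex_cubePoint {n : ℕ} (k : Fin (2 ^ n)) : cubeIndex (cubePoint n k) = k :=
  cubePoint_injective (cubePoint_cubeIndex _)

lemma truthTable_eq_ofFn {n : ℕ} (f : BoolFn n) :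
    f.truthTable = List.ofFn fun k : Fin (2 ^ n) => f (cubePoint n k) := rfl

/-- The number with binary digits `l`, least significant first. -/
def bitsToNat : List Bool → ℕ
  | [] => 0
  | b :: l => 2 * bitsToNat l + b.toNat

lemma testBit_bitsToNat (l : List Bool) (j : ℕ) : (bitsToNat l).testBit j = l.getD j false := by
  induction l generalizing j with
  | nil => simp [bitsToNat]
  | cons b l ih =>
    cases j with
    | zero => cases b <;> simp [bitsToNat, Nat.testBit_zero]
    | succ j =>
      rw [Nat.testBit_succ, show bitsToNat (b :: l) / 2 = bitsToNat l by
        cases b <;> simp [bitsToNat]; omega, ih]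
      rfl

lemma bitsToNat_ofFn {n : ℕ} (y : Fin n → Bool) : bitsToNat (List.ofFn y) = cubeIndex y := by
  refine Nat.eq_of_testBit_eq fun j => ?_
  rw [testBit_bitsToNat]
  by_cases hj : j < n
  · simp [cubeIndex, Nat.testBit_ofBits_lt, hj]
  · simp [cubeIndex, Nat.testBit_ofBits_ge, hj, not_lt.1 hj]

/-- The vectors of the help functions. -/
def helpVectors {n m : ℕ} (h : Fin m → BoolFn n) : List (Fin (2 ^ n) → ZMod 2) :=
  List.ofFn fun a k => bitToZMod (h a (cubePoint n k))

/-! ### A function outside the algebra generated by fewer than `n` functions -/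

/-- The function that is true at the first one of all the points with given values of the help
functions. -/
def firstInAtomFn {n m : ℕ} (h : Fin m → BoolFn n) : BoolFn n := fun y =>
  decide (∀ k < cubeIndex y, ∃ a, h a (cubePoint n k) ≠ h a y)

/-- With fewer than `n` help functions, two points share their values, and `firstInAtomFn` separates
points with this property. -/
lemma firstInAtomFn_not_mem_sizeDepth {n m : ℕ} (hm : m < n) (h : Fin m → BoolFn n) (s d : ℕ) :
    firstInAtomFn h ∉ SizeDepth h s d := by
  rintro ⟨t, -, C, o, -, hC⟩
  have hfactor : ∀ y z, (∀ a, h a y = h a z) → firstInAtomFn h y = firstInAtomFn h z := by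
    intro y z hyz
    rw [hC, hC, funext hyz]
  have hcard : Fintype.card (Fin m → Bool) < Fintype.card (Fin (2 ^ n)) := by
    simpa using Nat.pow_lt_pow_right one_lt_two hm
  obtain ⟨k₁, k₂, hne, heq⟩ := Fintype.exists_ne_map_eq_of_card_lt
    (fun (k : Fin (2 ^ n)) a => h a (cubePoint n k)) hcard
  wlog hlt : k₁ < k₂ generalizing k₁ k₂
  · exact this k₂ k₁ hne.symm heq.symm (lt_of_le_of_ne (not_lt.1 hlt) hne.symm)
  have hfalse : firstInAtomFn h (cubePoint n k₂) = false := by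
    simp only [firstInAtomFn, decide_eq_false_iff_not, cubeIndex_cubePoint]
    push Not
    exact ⟨k₁, hlt, congrFun heq⟩
  -- The first point of the atom of these two points has the value `true`.
  obtain ⟨k, hk, hmin⟩ := WellFounded.has_min (wellFounded_lt (α := Fin (2 ^ n)))
    {k | ∀ a, h a (cubePoint n k) = h a (cubePoint n k₂)} ⟨k₂, fun _ => rfl⟩
  have htrue : firstInAtomFn h (cubePoint n k) = true := by
    simp only [firstInAtomFn, decide_eq_true_eq, cubeIndex_cubePoint]
    intro k' hk'
    by_contra hcon
    push Not at hcon
    exact hmin k' (fun a => (hcon a).trans (hk a)) hk'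
  rw [hfactor _ _ hk, hfalse] at htrue
  exact Bool.false_ne_true htrue

/-! ### Estimates for the parameters -/

lemma eventually_mul_rpow_le_rpow {a b : ℝ} (hab : a < b) (K : ℝ) :
    ∀ᶠ t : ℝ in atTop, K * t ^ a ≤ t ^ b := by
  filter_upwards [(tendsto_rpow_atTop (sub_pos.2 hab)).eventually_ge_atTop K,
    eventually_gt_atTop 0] with t ht ht0
  rw [show b = (b - a) + a by ring, Real.rpow_add ht0]
  exact mul_le_mul_of_nonneg_right ht (Real.rpow_nonneg ht0.le _)

lemma tendsto_logb_two_natCast :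
    Tendsto (fun n : ℕ => Real.logb 2 (n : ℝ)) atTop atTop :=
  (Real.tendsto_logb_atTop one_lt_two).comp tendsto_natCast_atTop_atTop

lemma logb_two_natCast_lt_natLog_succ (n : ℕ) : Real.logb 2 n < (Nat.log 2 n + 1 : ℕ) := by
  have := Real.natFloor_logb_natCast 2 n
  rw [← this]
  push_cast
  exact Nat.lt_floor_add_one _

lemma natLog_succ_le_logb_two_add_one {n : ℕ} (hn : 0 < n) :
    ((Nat.log 2 n + 1 : ℕ) : ℝ) ≤ Real.logb 2 n + 1 := by
  have := Real.natFloor_logb_natCast 2 n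
  rw [← this]
  push_cast
  gcongr
  exact Nat.floor_le (Real.logb_nonneg one_lt_two (by exact_mod_cast hn))

lemma two_rpow_logb_natCast {n : ℕ} (hn : 0 < n) : (2 : ℝ) ^ Real.logb 2 n = n :=
  Real.rpow_logb (by norm_num) (by norm_num) (by exact_mod_cast hn)

lemma eventually_two_rpow_lt_natCast {c : ℝ} (hc : c < 1) :
    ∀ᶠ n : ℕ in atTop, (2 : ℝ) ^ (Real.logb 2 (n : ℝ) ^ c) < n := by
  filter_upwards [tendsto_logb_two_natCast.eventually (eventually_mul_rpow_le_rpow hc 2),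
    tendsto_logb_two_natCast.eventually_gt_atTop 0, eventually_gt_atTop 0] with n h1 h2 h3
  conv_rhs => rw [← two_rpow_logb_natCast h3]
  refine Real.rpow_lt_rpow_of_exponent_lt one_lt_two ?_
  have := Real.rpow_pos_of_pos h2 c
  rw [Real.rpow_one] at h1
  linarith

lemma eventually_two_rpow_le_quarter (c : ℝ) :
    ∀ᶠ n : ℕ in atTop, 4 * (2 : ℝ) ^ (Real.logb 2 (n : ℝ) ^ c) ≤ 2 ^ n := by
  have h := (isLittleO_rpow_exp_pos_mul_atTop c (Real.log_pos one_lt_two)).bound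
    (show (0 : ℝ) < 1 / 2 by norm_num)
  filter_upwards [tendsto_logb_two_natCast.eventually h,
    tendsto_logb_two_natCast.eventually_gt_atTop 0, eventually_ge_atTop 4] with n h1 h2 h3
  rw [Real.norm_of_nonneg (Real.rpow_nonneg h2.le _), Real.norm_of_nonneg (Real.exp_pos _).le,
    ← Real.rpow_def_of_pos two_pos, two_rpow_logb_natCast (by omega)] at h1
  have h4 : (4 : ℝ) ≤ n := by exact_mod_cast h3
  calc 4 * (2 : ℝ) ^ (Real.logb 2 (n : ℝ) ^ c)
      = 2 ^ (2 + Real.logb 2 (n : ℝ) ^ c) := by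
        rw [Real.rpow_add two_pos]; norm_num
    _ ≤ 2 ^ (n : ℝ) := Real.rpow_le_rpow_of_exponent_le one_le_two (by linarith)
    _ = 2 ^ n := Real.rpow_natCast _ _

lemma eventually_div_two_rpow_le {c : ℝ} (hc : 0 < c) :
    ∀ᶠ n : ℕ in atTop, (2 : ℝ) ^ n / 2 ^ (Real.logb 2 (n : ℝ) ^ c) ≤ 2 ^ n / 16 := by
  filter_upwards [((tendsto_rpow_atTop hc).comp tendsto_logb_two_natCast).eventually_ge_atTop 4]
    with n hn
  refine div_le_div_of_nonneg_left (by positivity) (by norm_num) ?_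
  calc (16 : ℝ) = 2 ^ (4 : ℝ) := by norm_num
    _ ≤ _ := Real.rpow_le_rpow_of_exponent_le one_le_two hn

/-- The number of products of `(log n) ^ e` help functions stays below the bound for the
dimension. -/
lemma eventually_succ_pow_le {c₀ c₂ : ℝ} (hc₂ : 0 < c₂) {e : ℕ} (he : e + c₂ < c₀) :
    ∀ᶠ n : ℕ in atTop, ∀ m : ℕ, (m : ℝ) ≤ 2 ^ (Real.logb 2 (n : ℝ) ^ c₂) →
      (((m + 1) ^ (Nat.log 2 n + 1) ^ e : ℕ) : ℝ) ≤ 2 ^ (Real.logb 2 (n : ℝ) ^ c₀) := by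
  filter_upwards [tendsto_logb_two_natCast.eventually (eventually_mul_rpow_le_rpow he (2 * 2 ^ e)),
    tendsto_logb_two_natCast.eventually_ge_atTop 1, eventually_gt_atTop 0] with n h1 h2 h3 m hm
  have hL := natLog_succ_le_logb_two_add_one h3
  set t := Real.logb 2 (n : ℝ) with ht
  have ht0 : 0 < t := by linarith
  have h4 : (1 : ℝ) ≤ t ^ c₂ := Real.one_le_rpow h2 hc₂.le
  have h5 : ((m + 1 : ℕ) : ℝ) ≤ 2 ^ (2 * t ^ c₂) := by
    calc ((m + 1 : ℕ) : ℝ) ≤ 2 ^ (t ^ c₂) + 2 ^ (t ^ c₂) := by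
          push_cast
          exact add_le_add hm (Real.one_le_rpow one_le_two (by positivity))
      _ = 2 ^ (1 + t ^ c₂) := by rw [Real.rpow_add two_pos, Real.rpow_one]; ring
      _ ≤ _ := Real.rpow_le_rpow_of_exponent_le one_le_two (by linarith)
  have h6 : (((Nat.log 2 n + 1) ^ e : ℕ) : ℝ) ≤ 2 ^ e * t ^ (e : ℝ) := by
    rw [Real.rpow_natCast, ← mul_pow]
    push_cast at hL ⊢
    exact pow_le_pow_left₀ (by positivity) (by linarith) _
  calc (((m + 1) ^ (Nat.log 2 n + 1) ^ e : ℕ) : ℝ)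
      = ((m + 1 : ℕ) : ℝ) ^ ((Nat.log 2 n + 1) ^ e) := by push_cast; rfl
    _ ≤ ((2 : ℝ) ^ (2 * t ^ c₂)) ^ ((Nat.log 2 n + 1) ^ e) :=
        pow_le_pow_left₀ (by positivity) h5 _
    _ = 2 ^ (2 * t ^ c₂ * ((Nat.log 2 n + 1) ^ e : ℕ)) := by
        rw [← Real.rpow_natCast, ← Real.rpow_mul two_pos.le]
    _ ≤ 2 ^ (t ^ c₀) := by
        refine Real.rpow_le_rpow_of_exponent_le one_le_two ?_
        refine le_trans ?_ h1
        rw [Real.rpow_add ht0]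
        calc 2 * t ^ c₂ * (((Nat.log 2 n + 1) ^ e : ℕ) : ℝ)
            ≤ 2 * t ^ c₂ * (2 ^ e * t ^ (e : ℝ)) := by gcongr
          _ = _ := by ring

/-- The degree per level `l` can be chosen such that the error of the approximation is below the
distance and `l ^ d` is below the number of factors. -/
lemma eventually_exists_degree {c₁ : ℝ} (hc₁ : 1 < c₁) {d e : ℕ} (he : d = 0 ∨ c₁ * d < e)
    (c : ℕ) :
    ∀ᶠ n : ℕ in atTop, ∃ l : ℕ, 0 < l ∧ l ^ d ≤ (Nat.log 2 n + 1) ^ e ∧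
      ((c * n ^ c : ℕ) : ℝ) * 2 ^ (Real.logb 2 (n : ℝ) ^ c₁) < 2 ^ l := by
  have hdeg : ∀ᶠ t : ℝ in atTop, d = 0 ∨ (4 : ℝ) ^ d * t ^ (c₁ * d) ≤ t ^ (e : ℝ) := by
    rcases he with h | h
    · exact Eventually.of_forall fun _ => Or.inl h
    · exact (eventually_mul_rpow_le_rpow h _).mono fun _ => Or.inr
  filter_upwards [tendsto_logb_two_natCast.eventually hdeg,
    tendsto_logb_two_natCast.eventually (eventually_mul_rpow_le_rpow hc₁ c),
    tendsto_logb_two_natCast.eventually_ge_atTop 1,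
    tendsto_logb_two_natCast.eventually_ge_atTop c, eventually_gt_atTop 0] with n h1 h2 h3 h4 h5
  have hL := logb_two_natCast_lt_natLog_succ n
  have hn := two_rpow_logb_natCast h5
  set t := Real.logb 2 (n : ℝ) with ht
  have ht0 : 0 < t := by linarith
  have h6 : t ≤ t ^ c₁ := by
    conv_lhs => rw [← Real.rpow_one t]
    exact Real.rpow_le_rpow_of_exponent_le h3 hc₁.le
  rw [Real.rpow_one] at h2
  refine ⟨⌊3 * t ^ c₁⌋₊ + 1, Nat.succ_pos _, ?_, ?_⟩
  · rcases h1 with h1 | h1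
    · rw [h1, pow_zero]; exact Nat.one_le_pow _ _ (Nat.succ_pos _)
    · have h7 : ((⌊3 * t ^ c₁⌋₊ + 1 : ℕ) : ℝ) ≤ 4 * t ^ c₁ := by
        have := Nat.floor_le (show 0 ≤ 3 * t ^ c₁ by positivity)
        push_cast; linarith
      have h8 : (((⌊3 * t ^ c₁⌋₊ + 1) ^ d : ℕ) : ℝ) ≤ ((Nat.log 2 n + 1) ^ e : ℕ) := by
        calc (((⌊3 * t ^ c₁⌋₊ + 1) ^ d : ℕ) : ℝ) = ((⌊3 * t ^ c₁⌋₊ + 1 : ℕ) : ℝ) ^ d := by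
              push_cast; rfl
          _ ≤ (4 * t ^ c₁) ^ d := pow_le_pow_left₀ (by positivity) h7 _
          _ = 4 ^ d * t ^ (c₁ * d) := by
              rw [mul_pow, Real.rpow_mul ht0.le, Real.rpow_natCast]
          _ ≤ t ^ (e : ℝ) := h1
          _ = t ^ e := Real.rpow_natCast _ _
          _ ≤ ((Nat.log 2 n + 1 : ℕ) : ℝ) ^ e := pow_le_pow_left₀ ht0.le hL.le _
          _ = _ := by push_cast; rfl
      exact_mod_cast h8
  · have h7 : ((c * n ^ c : ℕ) : ℝ) ≤ 2 ^ (t + c * t) := by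
      rw [Real.rpow_add two_pos, mul_comm (c : ℝ) t, Real.rpow_mul two_pos.le, hn,
        Real.rpow_natCast]
      rw [Nat.cast_mul, Nat.cast_pow]
      refine mul_le_mul_of_nonneg_right ?_ (by positivity)
      have : (c : ℝ) < 2 ^ c := by exact_mod_cast Nat.lt_two_pow_self
      calc (c : ℝ) ≤ 2 ^ (c : ℝ) := by rw [Real.rpow_natCast]; exact this.le
        _ ≤ 2 ^ t := Real.rpow_le_rpow_of_exponent_le one_le_two h4
        _ = n := hn
    calc ((c * n ^ c : ℕ) : ℝ) * 2 ^ (t ^ c₁) ≤ 2 ^ (t + c * t) * 2 ^ (t ^ c₁) := by gcongr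
      _ = 2 ^ (t + c * t + t ^ c₁) := (Real.rpow_add two_pos _ _).symm
      _ < 2 ^ ((⌊3 * t ^ c₁⌋₊ + 1 : ℕ) : ℝ) := by
          refine Real.rpow_lt_rpow_of_exponent_lt one_lt_two ?_
          have := Nat.lt_floor_add_one (3 * t ^ c₁)
          push_cast; linarith
      _ = _ := Real.rpow_natCast _ _

lemma exists_two_rpow_le_two_pow {c : ℝ} (hc : 0 < c) :
    ∃ b : ℕ, ∀ n : ℕ, 0 < n → (2 : ℝ) ^ (Real.logb 2 (n : ℝ) ^ c) ≤ (2 ^ n ^ b : ℕ) := by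
  refine ⟨⌈c⌉₊, fun n hn => ?_⟩
  have h1 : (1 : ℝ) ≤ n := by exact_mod_cast hn
  have h0 : 0 ≤ Real.logb 2 (n : ℝ) := Real.logb_nonneg one_lt_two h1
  have h2 : Real.logb 2 (n : ℝ) ≤ n := by
    rw [Real.logb_le_iff_le_rpow one_lt_two (by linarith), Real.rpow_natCast]
    exact_mod_cast Nat.lt_two_pow_self.le
  rw [Nat.cast_pow, Nat.cast_ofNat, ← Real.rpow_natCast]
  refine Real.rpow_le_rpow_of_exponent_le one_le_two ?_
  calc Real.logb 2 (n : ℝ) ^ c ≤ (n : ℝ) ^ c := Real.rpow_le_rpow h0 h2 hc.le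
    _ ≤ (n : ℝ) ^ (⌈c⌉₊ : ℝ) := Real.rpow_le_rpow_of_exponent_le h1 (Nat.le_ceil c)
    _ = _ := by rw [Real.rpow_natCast]; push_cast; rfl

namespace StackProg

/-! ### Running time as a power of a size parameter -/

/-- `Does Q j p σ τ`: started in `σ`, the program `p` halts in `τ` after at most `(Q + 2) ^ j`
steps. Here `Q` bounds the lengths of all the strings involved, so that sequential composition and loops
add a constant to `j`. -/
def Does (Q j : ℕ) (p : StackProg) (σ τ : Store) : Prop :=
  ∃ t ≤ (Q + 2) ^ j, Runs p σ t τ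

variable {Q i j : ℕ} {p q r : StackProg} {σ τ υ : Store} {x y z : ℕ}

lemma Does.mono (h : Does Q i p σ τ) (hij : i ≤ j) : Does Q j p σ τ := by
  obtain ⟨t, ht, hr⟩ := h
  exact ⟨t, ht.trans (Nat.pow_le_pow_right (by omega) hij), hr⟩

lemma Does.to (h : Does Q i p σ τ) (e : τ = υ) : Does Q i p σ υ := e ▸ h

lemma does_skip : Does Q 0 skip σ σ := ⟨1, by simp, .skip σ⟩

lemma does_push (x : ℕ) (b : Bool) : Does Q 0 (push x b) σ (Function.update σ x (b :: σ x)) :=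
  ⟨1, by simp, .push σ x b⟩

lemma does_pop (x : ℕ) : Does Q 0 (pop x) σ (Function.update σ x (σ x).tail) :=
  ⟨1, by simp, .pop σ x⟩

lemma Does.seq (h₁ : Does Q i p σ τ) (h₂ : Does Q j q τ υ) :
    Does Q (max i j + 1) (seq p q) σ υ := by
  obtain ⟨t, ht, hr⟩ := h₁.mono (le_max_left i j)
  obtain ⟨u, hu, hs⟩ := h₂.mono (le_max_right i j)
  refine ⟨t + u, ?_, hr.seq hs⟩
  rw [pow_succ]
  nlinarith [Nat.zero_le Q, Nat.zero_le ((Q + 2) ^ max i j)]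

lemma add_one_le_pow_succ {t : ℕ} (ht : t ≤ (Q + 2) ^ i) : t + 1 ≤ (Q + 2) ^ (i + 1) := by
  have : 1 ≤ (Q + 2) ^ i := Nat.one_le_pow _ _ (by omega)
  rw [pow_succ]
  nlinarith

lemma Does.branch_nil (hx : σ x = []) (h : Does Q i p σ τ) :
    Does Q (i + 1) (branch x p q r) σ τ := by
  obtain ⟨t, ht, hr⟩ := h
  exact ⟨t + 1, add_one_le_pow_succ ht, .branch_nil hx hr⟩

lemma Does.branch_cons {b : Bool} {l : List Bool} (hx : σ x = b :: l)
    (h : Does Q i (cond b r q) σ τ) : Does Q (i + 1) (branch x p q r) σ τ := by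
  obtain ⟨t, ht, hr⟩ := h
  cases b
  · exact ⟨t + 1, add_one_le_pow_succ ht, .branch_false hx hr⟩
  · exact ⟨t + 1, add_one_le_pow_succ ht, .branch_true hx hr⟩

/-- A loop whose stores before the rounds are `ρ 0, ρ 1, …, ρ k`. -/
lemma does_loop {k : ℕ} (hk : k ≤ Q) (ρ : ℕ → Store)
    (h : ∀ a < k, ρ a x ≠ [] ∧ Does Q i p (ρ a) (ρ (a + 1))) (hend : ρ k x = []) :
    Does Q (i + 2) (loop x p) (ρ 0) (ρ k) := by
  have key : ∀ b ≤ k, ∃ t ≤ b * ((Q + 2) ^ i + 1) + 1, Runs (loop x p) (ρ (k - b)) t (ρ k) := by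
    intro b
    induction b with
    | zero => exact fun _ => ⟨1, by simp, .loop_done hend⟩
    | succ b ih =>
      intro hb
      obtain ⟨t, ht, hr⟩ := ih (by omega)
      obtain ⟨hne, u, hu, hs⟩ := h (k - (b + 1)) (by omega)
      rw [show k - (b + 1) + 1 = k - b by omega] at hs
      refine ⟨u + t + 1, ?_, .loop_step hne hs hr⟩
      rw [Nat.succ_mul]
      omega
  obtain ⟨t, ht, hr⟩ := key k le_rfl
  rw [Nat.sub_self] at hr
  refine ⟨t, ht.trans ?_, hr⟩
  have h1 : 1 ≤ (Q + 2) ^ i := Nat.one_le_pow _ _ (by omega)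
  have h2 : k * ((Q + 2) ^ i + 1) ≤ Q * ((Q + 2) ^ i + 1) := Nat.mul_le_mul_right _ hk
  rw [pow_add]
  nlinarith

/-- A loop that consumes a list `l`, one entry per round: `enc s l'` is the store with state `s` and
entries `l'` left. -/
lemma does_loop_foldl {α β : Type*} (enc : α → List β → Store) (step : α → β → α) (l : List β)
    (s₀ : α) (hl : l.length ≤ Q) (hnil : ∀ s, enc s [] x = [])
    (h : ∀ l₁ b l₂, l = l₁ ++ b :: l₂ → enc (l₁.foldl step s₀) (b :: l₂) x ≠ [] ∧
      Does Q i p (enc (l₁.foldl step s₀) (b :: l₂)) (enc (step (l₁.foldl step s₀) b) l₂)) :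
    Does Q (i + 2) (loop x p) (enc s₀ l) (enc (l.foldl step s₀) []) := by
  have := does_loop (x := x) (p := p) (i := i) hl
    (fun a => enc ((l.take a).foldl step s₀) (l.drop a)) ?_ ?_
  · simpa using this
  · intro a ha
    have hsplit : l = l.take a ++ l[a] :: l.drop (a + 1) := by
      rw [← List.drop_eq_getElem_cons ha, List.take_append_drop]
    have := h _ _ _ hsplit
    rw [← List.drop_eq_getElem_cons ha] at this
    simpa only [List.take_succ_eq_append_getElem ha, List.foldl_append, List.foldl_cons,
      List.foldl_nil] using this
  · simp [hnil]

/-! ### Stores with finitely many named registers -/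

/-- The store with the strings `l` on the first stacks and the store `σ` on the stacks above. -/
def stackOn : List (List Bool) → Store → Store
  | [], σ => σ
  | a :: l, σ => fun i => Nat.casesOn i a (stackOn l σ)

@[simp] lemma stackOn_nil : stackOn [] σ = σ := rfl

@[simp] lemma stackOn_cons_zero (a : List Bool) (l : List (List Bool)) :
    stackOn (a :: l) σ 0 = a := rfl

@[simp] lemma stackOn_cons_succ (a : List Bool) (l : List (List Bool)) (i : ℕ) :
    stackOn (a :: l) σ (i + 1) = stackOn l σ i := rfl

lemma update_stackOn_cons_zero (a v : List Bool) (l : List (List Bool)) :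
    Function.update (stackOn (a :: l) σ) 0 v = stackOn (v :: l) σ := by
  funext i
  cases i <;> simp

lemma update_stackOn_cons_succ (a v : List Bool) (l : List (List Bool)) (i : ℕ) :
    Function.update (stackOn (a :: l) σ) (i + 1) v =
      stackOn [a] (Function.update (stackOn l σ) i v) := by
  funext k
  cases k with
  | zero => rfl
  | succ k => simp [Function.update_apply]

lemma stackOn_apply_add {l : List (List Bool)} {K : ℕ} (hl : l.length = K) (i : ℕ) :
    stackOn l σ (i + K) = σ i := by
  subst hl
  induction l with
  | nil => rfl
  | cons a l ih => exact ih

lemma update_stackOn {l : List (List Bool)} {i : ℕ} (hi : i < l.length) (v : List Bool) :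
    Function.update (stackOn l σ) i v = stackOn (l.set i v) σ := by
  induction l generalizing i with
  | nil => simp at hi
  | cons a l ih =>
    cases i with
    | zero => exact update_stackOn_cons_zero a v l
    | succ i =>
      rw [update_stackOn_cons_succ, ih (by simpa using hi)]
      rfl

lemma update_stackOn_add {l : List (List Bool)} {K : ℕ} (hl : l.length = K) (i : ℕ)
    (v : List Bool) :
    Function.update (stackOn l σ) (i + K) v = stackOn l (Function.update σ i v) := by
  subst hl
  induction l with
  | nil => rfl
  | cons a l ih =>
    rw [List.length_cons, ← add_assoc, update_stackOn_cons_succ, ih]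
    rfl

lemma stackOn_append (l l' : List (List Bool)) :
    stackOn (l ++ l') σ = stackOn l (stackOn l' σ) := by
  induction l with
  | nil => rfl
  | cons a l ih => rw [List.cons_append, stackOn, ih]; rfl

lemma load_eq_stackOn (l : List (List Bool)) : load l = stackOn l fun _ => [] := by
  induction l with
  | nil => rfl
  | cons a l ih =>
    funext i
    cases i with
    | zero => rfl
    | succ i => simpa [load] using congrFun ih i

lemma stackOn_append_replicate_nil (l : List (List Bool)) (k : ℕ) :
    stackOn (l ++ List.replicate k []) (fun _ => []) = stackOn l fun _ => [] := by
  rw [stackOn_append]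
  congr 1
  induction k with
  | zero => rfl
  | succ k ih =>
    rw [List.replicate_succ, stackOn, ih]
    funext i
    cases i <;> rfl

/-! ### Programs on renamed stacks -/

/-- The program `p` with every stack number increased by `K`. -/
def shift (K : ℕ) : StackProg → StackProg
  | skip => skip
  | push x b => push (x + K) b
  | pop x => pop (x + K)
  | seq p q => seq (shift K p) (shift K q)
  | branch x p q r => branch (x + K) (shift K p) (shift K q) (shift K r)
  | loop x p => loop (x + K) (shift K p)

lemma Runs.shift {l : List (List Bool)} {K t : ℕ} (hl : l.length = K) (h : Runs p σ t τ) :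
    Runs (p.shift K) (stackOn l σ) t (stackOn l τ) := by
  induction h with
  | skip σ => exact .skip _
  | push σ x b =>
    rw [← update_stackOn_add hl, ← stackOn_apply_add (σ := σ) hl x]
    exact .push _ _ _
  | pop σ x =>
    rw [← update_stackOn_add hl, ← stackOn_apply_add (σ := σ) hl x]
    exact .pop _ _
  | seq _ _ ih₁ ih₂ => exact .seq ih₁ ih₂
  | branch_nil hx _ ih => exact .branch_nil (by rwa [stackOn_apply_add hl]) ih
  | branch_false hx _ ih => exact .branch_false (by rwa [stackOn_apply_add hl]) ih
  | branch_true hx _ ih => exact .branch_true (by rwa [stackOn_apply_add hl]) ih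
  | loop_done hx => exact .loop_done (by rwa [stackOn_apply_add hl])
  | loop_step hx _ _ ih₁ ih₂ => exact .loop_step (by rwa [stackOn_apply_add hl]) ih₁ ih₂

/-! ### Basic string programs -/

/-- Consume the string on stack `x`, running `P b` for each of its bits `b`. -/
def forBits (x : ℕ) (P : Bool → StackProg) : StackProg :=
  loop x (branch x skip (seq (pop x) (P false)) (seq (pop x) (P true)))

lemma does_forBits {α : Type*} {P : Bool → StackProg} (enc : α → List Bool → Store)
    (step : α → Bool → α) (l : List Bool) (s₀ : α) (hl : l.length ≤ Q)
    (hx : ∀ s l, enc s l x = l)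
    (h : ∀ l₁ b l₂, l = l₁ ++ b :: l₂ → Does Q i (P b)
      (Function.update (enc (l₁.foldl step s₀) (b :: l₂)) x l₂)
      (enc (step (l₁.foldl step s₀) b) l₂)) :
    Does Q (i + 4) (forBits x P) (enc s₀ l) (enc (l.foldl step s₀) []) := by
  refine does_loop_foldl (i := i + 2) enc step l s₀ hl (fun s => hx s []) fun l₁ b l₂ hl' =>
    ⟨by simp [hx], ?_⟩
  refine Does.branch_cons (hx _ _) ?_
  have := ((does_pop (Q := Q) (σ := enc (l₁.foldl step s₀) (b :: l₂)) x).to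
    (by rw [hx]; rfl)).seq (h l₁ b l₂ hl')
  cases b <;> exact this.mono (by simp)

/-- Move the string on stack `x` to stack `y`; this reverses it. -/
def move (x y : ℕ) : StackProg := forBits x (push y)

lemma does_move (hxy : x ≠ y) (hl : (σ x).length ≤ Q) :
    Does Q 4 (move x y) σ
      (Function.update (Function.update σ y ((σ x).reverse ++ σ y)) x []) := by
  have := does_forBits (x := x) (P := push y) (i := 0)
    (fun s l => Function.update (Function.update σ y s) x l) (fun s b => b :: s) (σ x) (σ y) hl
    (by simp) (fun l₁ b l₂ _ => (does_push y b).to (by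
      funext k
      simp only [Function.update_apply]
      split_ifs <;> simp_all))
  rw [move]
  simpa [List.foldl_flip_cons_eq_append, Function.update_eq_self] using this

/-- Push a copy of stack `x` on stack `y`, with the empty stack `z` as intermediate storage. -/
def copy (x y z : ℕ) : StackProg :=
  seq (move x z) (forBits z fun b => seq (push x b) (push y b))

lemma does_copy (hxy : x ≠ y) (hxz : x ≠ z) (hyz : y ≠ z) (hz : σ z = [])
    (hl : (σ x).length ≤ Q) :
    Does Q 6 (copy x y z) σ (Function.update σ y (σ x ++ σ y)) := by
  refine ((does_move hxz hl).seq (j := 5) ?_).mono (by decide)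
  have := does_forBits (Q := Q) (x := z) (P := fun b => seq (push x b) (push y b)) (i := 1)
    (fun s l => Function.update (Function.update (Function.update σ y (s ++ σ y)) x s) z l)
    (fun s b => b :: s) (σ x).reverse [] (by simpa using hl) (by simp)
    (fun l₁ b l₂ _ => ((does_push x b).seq (does_push y b)).to (by
      funext k
      simp only [Function.update_apply]
      split_ifs <;> simp_all))
  convert this using 1
  · funext k
    simp only [Function.update_apply]
    split_ifs <;> simp_all
  · funext k
    simp only [Function.update_apply, List.foldl_flip_cons_eq_append']
    split_ifs <;> simp_all

/-- Empty the stack `x`. -/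
def clear (x : ℕ) : StackProg := forBits x fun _ => skip

lemma does_clear (hl : (σ x).length ≤ Q) :
    Does Q 4 (clear x) σ (Function.update σ x []) := by
  have := does_forBits (Q := Q) (x := x) (P := fun _ => skip) (i := 0)
    (fun (_ : Unit) l => Function.update σ x l) (fun s _ => s) (σ x) () hl
    (by simp) (fun l₁ b l₂ _ => does_skip.to (by simp))
  rw [clear]
  simpa [Function.update_eq_self] using this

/-- Move the top bit of stack `x` to stack `y`. -/
def forward (x y : ℕ) : StackProg :=
  branch x skip (seq (push y false) (pop x)) (seq (push y true) (pop x))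

lemma does_forward (hxy : x ≠ y) {b : Bool} {l : List Bool} (hx : σ x = b :: l) :
    Does Q 2 (forward x y) σ (Function.update (Function.update σ y (b :: σ y)) x l) := by
  refine Does.branch_cons hx ?_
  cases b <;> exact ((does_push y _).seq (does_pop x)).to (by simp [hxy, hx])


/-! ### Registers -/

/-- Names for the first stacks. The input strings are expected in `X` and `T`; `In₀` and `In₁` are
the first two of the stacks on which a shifted program runs. -/
structure Regs where
  (X T O W U V Z C S B R D L In₀ In₁ : List Bool)

-- The number of the stack that holds each register.
abbrev rX : ℕ := 0
abbrev rT : ℕ := 1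
abbrev rO : ℕ := 2
abbrev rW : ℕ := 3
abbrev rU : ℕ := 4
abbrev rV : ℕ := 5
abbrev rZ : ℕ := 6
abbrev rC : ℕ := 7
abbrev rS : ℕ := 8
abbrev rB : ℕ := 9
abbrev rR : ℕ := 10
abbrev rD : ℕ := 11
abbrev rL : ℕ := 12
abbrev rIn₀ : ℕ := 13
abbrev rIn₁ : ℕ := 14

namespace Regs

/-- The store with the given registers and the store `ρ` on the stacks above. -/
def store (s : Regs) (ρ : Store) : Store :=
  stackOn [s.X, s.T, s.O, s.W, s.U, s.V, s.Z, s.C, s.S, s.B, s.R, s.D, s.L, s.In₀, s.In₁] ρ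

variable (s : Regs) (ρ : Store) (v : List Bool)

@[simp] lemma store_rX : s.store ρ rX = s.X := rfl
@[simp] lemma store_rT : s.store ρ rT = s.T := rfl
@[simp] lemma store_rO : s.store ρ rO = s.O := rfl
@[simp] lemma store_rW : s.store ρ rW = s.W := rfl
@[simp] lemma store_rU : s.store ρ rU = s.U := rfl
@[simp] lemma store_rV : s.store ρ rV = s.V := rfl
@[simp] lemma store_rZ : s.store ρ rZ = s.Z := rfl
@[simp] lemma store_rC : s.store ρ rC = s.C := rfl
@[simp] lemma store_rS : s.store ρ rS = s.S := rfl
@[simp] lemma store_rB : s.store ρ rB = s.B := rfl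
@[simp] lemma store_rR : s.store ρ rR = s.R := rfl
@[simp] lemma store_rD : s.store ρ rD = s.D := rfl
@[simp] lemma store_rL : s.store ρ rL = s.L := rfl
@[simp] lemma store_rIn₀ : s.store ρ rIn₀ = s.In₀ := rfl
@[simp] lemma store_rIn₁ : s.store ρ rIn₁ = s.In₁ := rfl

@[simp] lemma update_rX : Function.update (s.store ρ) rX v = store {s with X := v} ρ :=
  update_stackOn (Nat.le_of_ble_eq_true rfl) v
@[simp] lemma update_rT : Function.update (s.store ρ) rT v = store {s with T := v} ρ :=
  update_stackOn (Nat.le_of_ble_eq_true rfl) v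
@[simp] lemma update_rO : Function.update (s.store ρ) rO v = store {s with O := v} ρ :=
  update_stackOn (Nat.le_of_ble_eq_true rfl) v
@[simp] lemma update_rW : Function.update (s.store ρ) rW v = store {s with W := v} ρ :=
  update_stackOn (Nat.le_of_ble_eq_true rfl) v
@[simp] lemma update_rU : Function.update (s.store ρ) rU v = store {s with U := v} ρ :=
  update_stackOn (Nat.le_of_ble_eq_true rfl) v
@[simp] lemma update_rV : Function.update (s.store ρ) rV v = store {s with V := v} ρ :=
  update_stackOn (Nat.le_of_ble_eq_true rfl) v
@[simp] lemma update_rZ : Function.update (s.store ρ) rZ v = store {s with Z := v} ρ :=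
  update_stackOn (Nat.le_of_ble_eq_true rfl) v
@[simp] lemma update_rC : Function.update (s.store ρ) rC v = store {s with C := v} ρ :=
  update_stackOn (Nat.le_of_ble_eq_true rfl) v
@[simp] lemma update_rS : Function.update (s.store ρ) rS v = store {s with S := v} ρ :=
  update_stackOn (Nat.le_of_ble_eq_true rfl) v
@[simp] lemma update_rB : Function.update (s.store ρ) rB v = store {s with B := v} ρ :=
  update_stackOn (Nat.le_of_ble_eq_true rfl) v
@[simp] lemma update_rR : Function.update (s.store ρ) rR v = store {s with R := v} ρ :=
  update_stackOn (Nat.le_of_ble_eq_true rfl) v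
@[simp] lemma update_rD : Function.update (s.store ρ) rD v = store {s with D := v} ρ :=
  update_stackOn (Nat.le_of_ble_eq_true rfl) v
@[simp] lemma update_rL : Function.update (s.store ρ) rL v = store {s with L := v} ρ :=
  update_stackOn (Nat.le_of_ble_eq_true rfl) v
@[simp] lemma update_rIn₀ : Function.update (s.store ρ) rIn₀ v = store {s with In₀ := v} ρ :=
  update_stackOn (Nat.le_of_ble_eq_true rfl) v
@[simp] lemma update_rIn₁ : Function.update (s.store ρ) rIn₁ v = store {s with In₁ := v} ρ :=
  update_stackOn (Nat.le_of_ble_eq_true rfl) v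

end Regs

/-- Run one program after the other. -/
infixr:60 " ;; " => StackProg.seq

variable {Q i j : ℕ} {p q r : StackProg} {σ τ : Store} {x y z v : ℕ} {s : Regs} {ρ : Store}

lemma Does.cast {σ' τ' : Store} (h : Does Q i p σ τ) (e₁ : σ = σ') (e₂ : τ = τ') :
    Does Q i p σ' τ' := e₁ ▸ e₂ ▸ h

/-! ### Selecting an entry of a table -/

lemma foldl_cons_map {α β : Type*} (φ : α → β) (l : List α) (s : List β) :
    l.foldl (fun s a => φ a :: s) s = (l.map φ).reverse ++ s := by
  induction l generalizing s with
  | nil => rfl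
  | cons a l ih => simp [ih]

/-- Keep on stack `x` the entries in odd positions if `b`, in even positions otherwise; the stack
`z` is intermediate storage. -/
def halve (b : Bool) (x z : ℕ) : StackProg :=
  loop x (if b then pop x ;; forward x z else forward x z ;; pop x) ;; move z x

lemma does_halve {b : Bool} (hxz : x ≠ z) (l : List (Bool × Bool))
    (hx : σ x = l.flatMap fun a => [a.1, a.2]) (hz : σ z = []) (hl : l.length ≤ Q) :
    Does Q 6 (halve b x z) σ (Function.update σ x (l.map fun a => cond b a.2 a.1)) := by
  have h1 := does_loop_foldl (Q := Q) (x := x) (i := 3)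
    (p := if b then pop x ;; forward x z else forward x z ;; pop x)
    (fun (s : List Bool) (l : List (Bool × Bool)) =>
      Function.update (Function.update σ z s) x (l.flatMap fun a => [a.1, a.2]))
    (fun s a => cond b a.2 a.1 :: s) l [] hl (by simp) (fun l₁ a l₂ _ => ⟨by simp, by
      cases b
      · refine ((does_forward (Q := Q) hxz (b := a.1)
          (l := a.2 :: l₂.flatMap fun a => [a.1, a.2]) ?_).seq (does_pop x)).cast rfl ?_
        · simp
        · funext k
          simp only [Function.update_apply]
          split_ifs <;> simp_all
      · refine ((does_pop (Q := Q) x).seq (does_forward hxz (b := a.2)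
          (l := l₂.flatMap fun a => [a.1, a.2]) ?_)).cast rfl ?_
        · simp
        · funext k
          simp only [Function.update_apply]
          split_ifs <;> simp_all⟩)
  rw [foldl_cons_map] at h1
  refine (Does.seq (h1.cast ?_ rfl) ((does_move hxz.symm (by simp [hxz.symm, hl])).to ?_)).mono
    (by decide)
  · funext k
    simp only [Function.update_apply]
    split_ifs <;> simp_all
  · funext k
    simp only [Function.update_apply]
    split_ifs <;> simp_all

/-- Replace the table on stack `v` by its entry at the point whose coordinates are on stack `x`. -/
def select (v x z : ℕ) : StackProg := forBits x fun b => halve b v z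

lemma flatMap_range_pair (F : ℕ → Bool) (k : ℕ) :
    (List.range (2 * k)).map F =
      ((List.range k).map fun i => (F (2 * i), F (2 * i + 1))).flatMap fun a => [a.1, a.2] := by
  induction k with
  | zero => rfl
  | succ k ih =>
    rw [show 2 * (k + 1) = 2 * k + 1 + 1 by ring, List.range_succ, List.range_succ,
      List.range_succ (n := k)]
    simp [ih]

lemma does_select {n : ℕ} (hvx : v ≠ x) (hvz : v ≠ z) (hxz : x ≠ z) (f : Fin (2 ^ n) → Bool)
    (y : Fin n → Bool) (hv : σ v = List.ofFn f) (hx : σ x = List.ofFn y) (hz : σ z = [])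
    (hQ : 2 ^ n ≤ Q) :
    Does Q 10 (select v x z) σ
      (Function.update (Function.update σ v [f (cubeIndex y)]) x []) := by
  have hn : n ≤ Q := Nat.lt_two_pow_self.le.trans hQ
  -- The state `(k, F)` stands for the table of the values of `F` on `0, …, 2 ^ k - 1`.
  let step : ℕ × (ℕ → Bool) → Bool → ℕ × (ℕ → Bool) :=
    fun s b => (s.1 - 1, fun i => s.2 (2 * i + b.toNat))
  let F : ℕ → Bool := fun i => if h : i < 2 ^ n then f ⟨i, h⟩ else false
  have hfst : ∀ (l : List Bool) (s : ℕ × (ℕ → Bool)), (l.foldl step s).1 = s.1 - l.length := by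
    intro l
    induction l with
    | nil => simp
    | cons b l ih => intro s; rw [List.foldl_cons, ih, List.length_cons]; simp [step]; omega
  have hsnd : ∀ (l : List Bool) (s : ℕ × (ℕ → Bool)) (i : ℕ),
      (l.foldl step s).2 i = s.2 (2 ^ l.length * i + bitsToNat l) := by
    intro l
    induction l with
    | nil => simp [bitsToNat]
    | cons b l ih =>
      intro s i
      rw [List.foldl_cons, ih]
      simp only [step, bitsToNat, List.length_cons]
      exact congrArg s.2 (by rw [pow_succ]; ring)
  have h := does_forBits (Q := Q) (x := x) (P := fun b => halve b v z) (i := 6)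
    (fun s l => Function.update (Function.update σ v ((List.range (2 ^ s.1)).map s.2)) x l)
    step (List.ofFn y) (n, F) (by simpa using hn) (by simp) (fun l₁ b l₂ hl => by
      have hlen : l₁.length < n := by
        have := congrArg List.length hl
        simp at this
        omega
      obtain ⟨k, hk⟩ : ∃ k, (l₁.foldl step (n, F)).1 = k + 1 :=
        ⟨n - l₁.length - 1, by rw [hfst]; simp only; omega⟩
      have hk2 : 2 ^ k ≤ Q := by
        refine (Nat.pow_le_pow_right two_pos ?_).trans hQ
        rw [hfst] at hk
        simp only at hk
        omega
      set s := l₁.foldl step (n, F)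
      refine (does_halve (b := b) hvz
        ((List.range (2 ^ k)).map fun i => (s.2 (2 * i), s.2 (2 * i + 1))) ?_ ?_ ?_).to ?_
      · simp only [Function.update_of_ne hvx, Function.update_self, hk]
        rw [← flatMap_range_pair, pow_succ']
      · simp [hxz.symm, hvz.symm, hz]
      · simpa using hk2
      · have hstep : (step s b).1 = k := by simp [step, hk]
        rw [hstep]
        funext a
        simp only [Function.update_apply]
        split_ifs <;> simp_all [step]
        cases b <;> simp)
  refine h.cast ?_ ?_
  · rw [show List.map (n, F).2 (List.range (2 ^ (n, F).1)) = List.ofFn f by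
      refine List.ext_getElem (by simp) fun i h1 h2 => ?_
      have : i < 2 ^ n := by simpa using h1
      simp [F, this], ← hv, ← hx]
    simp
  · have h1 : (List.foldl step (n, F) (List.ofFn y)).1 = 0 := by rw [hfst]; simp
    have h2 : (List.foldl step (n, F) (List.ofFn y)).2 0 = f (cubeIndex y) := by
      rw [hsnd, mul_zero, zero_add, bitsToNat_ofFn]
      simp [F]
    rw [h1]
    simp [h2]

/-! ### Blocks -/

/-- Split off from `T` a block of the length of `O` and push it in reverse on `U`. -/
def takeBlock : StackProg := copy rO rC rS ;; loop rC (pop rC ;; forward rT rU)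

lemma does_takeBlock (l l' : List Bool) (hT : s.T = l ++ l')
    (hO : s.O = List.replicate l.length true) (hC : s.C = []) (hS : s.S = []) (hl : l.length ≤ Q) :
    Does Q 10 takeBlock (s.store ρ) (Regs.store {s with T := l', U := l.reverse ++ s.U} ρ) := by
  have h1 : Does Q 6 (copy rO rC rS) (s.store ρ)
      (Regs.store {s with C := List.replicate l.length true} ρ) :=
    (does_copy (by decide) (by decide) (by decide) (by simpa using hS)
      (by simpa [hO] using hl)).to (by simp [hO, hC])
  have h2 := does_loop_foldl (Q := Q) (x := rC) (p := pop rC ;; forward rT rU) (i := 3)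
    (fun u (l : List Bool) => Regs.store {s with
      C := List.replicate l.length true, T := l ++ l', U := u} ρ)
    (fun u b => b :: u) l s.U hl (by simp) (fun l₁ b l₂ _ => ⟨by simp [List.replicate_succ],
      ((does_pop rC).seq (does_forward (by decide) (b := b) (l := l₂ ++ l') (by simp))).to
        (by simp)⟩)
  refine (h1.seq (h2.cast ?_ ?_)).mono (by decide)
  · simp [← hT]
  · rw [List.foldl_flip_cons_eq_append']
    simp [hC]

/-- From a point with `n` coordinates in `X`, make `O` a string of length `2 ^ n`. -/
def ones : StackProg :=
  copy rX rC rS ;; push rO true ;;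
    forBits rC fun _ => forBits rO (fun _ => push rS true ;; push rS true) ;; move rS rO

lemma does_ones {n : ℕ} (hX : s.X.length = n) (hO : s.O = []) (hC : s.C = []) (hS : s.S = [])
    (hQ : 2 ^ n ≤ Q) :
    Does Q 15 ones (s.store ρ) (Regs.store {s with O := List.replicate (2 ^ n) true} ρ) := by
  have hn : n ≤ Q := Nat.lt_two_pow_self.le.trans hQ
  have h1 : Does Q 6 (copy rX rC rS) (s.store ρ) (Regs.store {s with C := s.X} ρ) :=
    (does_copy (by decide) (by decide) (by decide) (by simpa using hS)
      (by simpa [hX] using hn)).to (by simp [hC])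
  have h2 : Does Q 0 (push rO true) (Regs.store {s with C := s.X} ρ)
      (Regs.store {s with C := s.X, O := [true]} ρ) := (does_push _ _).to (by simp [hO])
  have hdouble : ∀ (c : List Bool) (k : ℕ), 2 * k ≤ Q →
      Does Q 6 (forBits rO (fun _ => push rS true ;; push rS true) ;; move rS rO)
        (Regs.store {s with C := c, O := List.replicate k true} ρ)
        (Regs.store {s with C := c, O := List.replicate (2 * k) true} ρ) := by
    intro c k hk
    have h := does_forBits (Q := Q) (x := rO) (P := fun _ => push rS true ;; push rS true) (i := 1)
      (fun (a : ℕ) l => Regs.store {s with C := c, O := l, S := List.replicate a true} ρ)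
      (fun a _ => a + 2) (List.replicate k true) 0 (by simp; omega) (by simp)
      (fun l₁ b l₂ _ => ((does_push _ _).seq (does_push _ _)).to
        (by simp [List.replicate_succ]))
    have hfold : ∀ (l : List Bool) (a : ℕ), l.foldl (fun a _ => a + 2) a = a + 2 * l.length := by
      intro l
      induction l with
      | nil => simp
      | cons b l ih => intro a; rw [List.foldl_cons, ih, List.length_cons]; ring
    refine (Does.seq (h.cast ?_ rfl) ((does_move (by decide) ?_).to ?_)).mono (by decide)
    · simp [← hS]
    · simp [hfold, hk]
    · simp [hfold, hS]
  have h3 := does_forBits (Q := Q) (x := rC) (i := 6)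
    (P := fun _ => forBits rO (fun _ => push rS true ;; push rS true) ;; move rS rO)
    (fun (a : ℕ) l => Regs.store {s with C := l, O := List.replicate (2 ^ a) true} ρ)
    (fun a _ => a + 1) s.X 0 (by omega) (by simp) (fun l₁ b l₂ hl => by
      have hlen : l₁.length < n := by
        have := congrArg List.length hl
        simp at this
        omega
      have hfold : l₁.foldl (fun a _ => a + 1) 0 = l₁.length := by simp
      rw [hfold]
      refine (hdouble l₂ (2 ^ l₁.length) ?_).cast (by simp) (by simp [pow_succ'])
      rw [← pow_succ']
      exact (Nat.pow_le_pow_right two_pos hlen).trans hQ)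
  refine (h1.seq (h2.seq (h3.cast ?_ ?_))).mono (by decide)
  · simp
  · simp [hX, ← hC]


/-! ### The first point of an atom of the help functions -/

/-- Compare the tops of `V` and `Z`, and push on `S` whether they agree and the top of `W` is
`true`. -/
def compareTops : StackProg :=
  .branch rW .skip (.push rS false)
    (.branch rV .skip (.branch rZ .skip (.push rS true) (.push rS false))
      (.branch rZ .skip (.push rS false) (.push rS true))) ;; .pop rW ;; .pop rV

lemma does_compareTops {a b c : Bool} {w v z : List Bool} (hW : s.W = a :: w) (hV : s.V = b :: v)
    (hZ : s.Z = c :: z) :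
    Does Q 10 compareTops (s.store ρ)
      (Regs.store {s with W := w, V := v, S := (a && (b == c)) :: s.S} ρ) := by
  refine (Does.seq (i := 3) (τ := Regs.store {s with S := (a && (b == c)) :: s.S} ρ) ?_
    (((does_pop rW).seq (does_pop rV)).to (by simp [hW, hV]))).mono (by decide)
  cases a
  · exact (Does.branch_cons hW ((does_push rS false).to (by simp))).mono (by decide)
  · refine Does.branch_cons hW (Does.branch_cons hV ?_)
    cases b
    all_goals
      refine Does.branch_cons hZ ?_
      cases c <;> exact (does_push rS _).to (by simp)

/-- Split off the table of one help function and keep in `W` the entries at those points where this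
function has the same value as at the point in `X`. -/
def atomStep : StackProg :=
  takeBlock ;; forBits rU (fun b => .push rV b ;; .push rZ b) ;; copy rX rC rS ;;
    select rZ rC rS ;; .loop rW compareTops ;; move rS rW ;; .pop rZ

lemma does_atomStep {n : ℕ} {y : Fin n → Bool} (f : BoolFn n) (E : Fin (2 ^ n) → Bool)
    {l : List Bool} (hX : s.X = List.ofFn y) (hT : s.T = f.truthTable ++ l)
    (hO : s.O = List.replicate (2 ^ n) true) (hW : s.W = List.ofFn E) (hU : s.U = [])
    (hV : s.V = []) (hZ : s.Z = []) (hC : s.C = []) (hS : s.S = []) (hQ : 2 ^ n ≤ Q) :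
    Does Q 25 atomStep (s.store ρ) (Regs.store {s with
      T := l, W := List.ofFn fun k => E k && (f (cubePoint n k) == f y)} ρ) := by
  have hn : n ≤ Q := Nat.lt_two_pow_self.le.trans hQ
  have hlen : f.truthTable.length = 2 ^ n := by simp [BoolFn.truthTable]
  have h1 : Does Q 10 takeBlock (s.store ρ)
      (Regs.store {s with T := l, U := f.truthTable.reverse} ρ) :=
    (does_takeBlock _ l hT (by rw [hO, hlen]) hC hS (hlen.trans_le hQ)).to (by simp [hU])
  have h2 := does_forBits (Q := Q) (x := rU) (P := fun b => .push rV b ;; .push rZ b) (i := 1)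
    (fun v u => Regs.store {s with T := l, U := u, V := v, Z := v} ρ) (fun v b => b :: v)
    f.truthTable.reverse [] (by simpa [hlen] using hQ) (by simp)
    (fun l₁ b l₂ _ => ((does_push rV b).seq (does_push rZ b)).to (by simp))
  rw [List.foldl_flip_cons_eq_append', List.reverse_reverse, List.append_nil] at h2
  have h3 : Does Q 6 (copy rX rC rS)
      (Regs.store {s with T := l, U := [], V := f.truthTable, Z := f.truthTable} ρ)
      (Regs.store {s with
        T := l, U := [], V := f.truthTable, Z := f.truthTable, C := List.ofFn y} ρ) :=
    (does_copy (by decide) (by decide) (by decide) hS (by simpa [hX] using hn)).to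
      (by simp [hX, hC])
  have h4 : Does Q 10 (select rZ rC rS) (Regs.store {s with
        T := l, U := [], V := f.truthTable, Z := f.truthTable, C := List.ofFn y} ρ)
      (Regs.store {s with T := l, U := [], V := f.truthTable, Z := [f y], C := []} ρ) :=
    (does_select (by decide) (by decide) (by decide) (fun k => f (cubePoint n k)) y rfl rfl hS
      hQ).to (by simp)
  have h5 := does_loop_foldl (Q := Q) (x := rW) (p := compareTops) (i := 10)
    (fun acc (l' : List (Bool × Bool)) => Regs.store {s with
      T := l, U := [], V := l'.map Prod.snd, Z := [f y], C := [], W := l'.map Prod.fst,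
      S := acc} ρ)
    (fun acc a => (a.1 && (a.2 == f y)) :: acc)
    (List.ofFn fun k => (E k, f (cubePoint n k))) [] (by simpa using hQ) (by simp)
    (fun l₁ b l₂ _ => ⟨by simp, (does_compareTops (a := b.1) (b := b.2) rfl rfl rfl).to (by simp)⟩)
  rw [foldl_cons_map, List.map_ofFn, List.map_ofFn, List.map_ofFn] at h5
  have h6 : Does Q 4 (move rS rW) (Regs.store {s with
        T := l, U := [], V := [], Z := [f y], C := [], W := [],
        S := (List.ofFn fun k => E k && (f (cubePoint n k) == f y)).reverse} ρ)
      (Regs.store {s with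
        T := l, U := [], V := [], Z := [f y], C := [],
        W := List.ofFn (fun k => E k && (f (cubePoint n k) == f y)), S := []} ρ) :=
    (does_move (by decide) (by simpa using hQ)).to (by simp)
  refine ((h1.seq ((h2.cast ?_ rfl).seq (h3.seq (h4.seq ((h5.cast ?_ ?_).seq (h6.seq
    ((does_pop rZ).to ?_))))))).mono (by decide))
  · simp [hV, hZ]
  · simp [hW, hS, truthTable_eq_ofFn, Function.comp_def]
  · simp [Function.comp_def]
  · simp [hU, hV, hZ, hC, hS]

/-- Replace all entries of `W` but the first `true` by `false`. -/
def keepFirst : StackProg :=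
  forBits rW (fun b => .branch rV (if b then .push rV true ;; .push rS true else .push rS false)
    (.push rS false) (.push rS false)) ;; clear rV ;; move rS rW

lemma does_keepFirst {N : ℕ} (E : Fin N → Bool) (hW : s.W = List.ofFn E) (hV : s.V = [])
    (hS : s.S = []) (hQ : N ≤ Q) :
    Does Q 20 keepFirst (s.store ρ) (Regs.store {s with
      W := List.ofFn fun k => E k && decide (∀ k' < k, E k' = false)} ρ) := by
  -- The state is whether a `true` has been found, and the output so far.
  let step : Bool × List Bool → Bool → Bool × List Bool := fun a b => (a.1 || b, (b && !a.1) :: a.2)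
  have h1 := does_forBits (Q := Q) (x := rW) (i := 2)
    (P := fun b => .branch rV (if b then .push rV true ;; .push rS true else .push rS false)
      (.push rS false) (.push rS false))
    (fun (a : Bool × List Bool) l => Regs.store {s with
      W := l, V := if a.1 then [true] else [], S := a.2} ρ) step
    (List.ofFn E) (false, []) (by simpa using hQ) (by simp) (fun l₁ b l₂ _ => by
      rcases l₁.foldl step (false, []) with ⟨found, acc⟩
      cases found
      · refine Does.branch_nil (by simp) ?_
        cases b
        · exact ((does_push rS false).to (by simp [step])).mono (by decide)
        · exact ((does_push rV true).seq (does_push rS true)).to (by simp [step])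
      · exact (Does.branch_cons (b := true) (l := []) (by simp)
          ((does_push rS false).to (by simp [step]))).mono (by decide))
  have hfold : ∀ (M : ℕ) (E : Fin M → Bool), (List.ofFn E).foldl step (false, []) =
      (decide (∃ k, E k = true),
        (List.ofFn fun k => E k && decide (∀ k' < k, E k' = false)).reverse) := by
    intro M
    induction M with
    | zero => simp
    | succ M ih =>
      intro E
      rw [List.ofFn_succ', List.concat_eq_append, List.foldl_append, ih,
        List.ofFn_succ' (f := fun k : Fin (M + 1) => E k && _), List.concat_eq_append]
      simp only [List.foldl_cons, List.foldl_nil, step, List.reverse_append, List.reverse_cons,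
        List.reverse_nil, List.nil_append, List.singleton_append, Fin.exists_fin_succ']
      have hlast : (∀ k' < Fin.last M, E k' = false) ↔ ¬ ∃ k : Fin M, E k.castSucc = true := by
        simp [Fin.forall_fin_succ', Fin.castSucc_lt_last]
      have hcast : ∀ k : Fin M, (∀ k' < k.castSucc, E k' = false) ↔
          ∀ k' < k, E k'.castSucc = false := by
        intro k
        simp [Fin.forall_fin_succ', (Fin.castSucc_lt_last k).le]
      simp only [hlast, hcast, decide_not, Bool.decide_or, Bool.decide_eq_true]
  rw [hfold] at h1
  set F := fun k => E k && decide (∀ k' < k, E k' = false)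
  have h2 : ∀ v : List Bool, v.length ≤ Q → Does Q 4 (clear rV)
      (Regs.store {s with W := [], V := v, S := (List.ofFn F).reverse} ρ)
      (Regs.store {s with W := [], V := [], S := (List.ofFn F).reverse} ρ) :=
    fun v hv => (does_clear hv).to (by simp)
  have h3 : Does Q 4 (move rS rW)
      (Regs.store {s with W := [], V := [], S := (List.ofFn F).reverse} ρ)
      (Regs.store {s with W := List.ofFn F, V := [], S := []} ρ) :=
    (does_move (by decide) (by simpa using hQ)).to (by simp)
  refine ((h1.cast ?_ rfl).seq ((h2 _ ?_).seq (h3.to ?_))).mono (by decide)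
  · clear h1 h2 h3
    cases s
    simp_all
  · split_ifs with hex
    · obtain ⟨k, -⟩ := of_decide_eq_true hex
      exact (Nat.succ_le_of_lt k.pos).trans hQ
    · exact Nat.zero_le _
  · simp [hV, hS]

/-- On a point in `X` and the tables of the help functions in `T`: is this point the first one of
all the points with the same values of the help functions? -/
def firstInAtom : StackProg :=
  ones ;; copy rO rW rS ;; .loop rT atomStep ;; keepFirst ;; select rW rX rS ;; move rW rX

lemma does_firstInAtom {n m : ℕ} (h : Fin m → BoolFn n) (y : Fin n → Bool) (hQ : 2 ^ n ≤ Q)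
    (hm : m ≤ Q) :
    ∃ τ, τ 0 = [firstInAtomFn h y] ∧ Does Q 35 firstInAtom
      (load [List.ofFn y, (List.ofFn fun a => (h a).truthTable).flatten]) τ := by
  let s : Regs := ⟨List.ofFn y, (List.ofFn fun a => (h a).truthTable).flatten,
    [], [], [], [], [], [], [], [], [], [], [], [], []⟩
  have h0 : load [List.ofFn y, (List.ofFn fun a => (h a).truthTable).flatten] =
      s.store fun _ => [] := by
    rw [load_eq_stackOn, ← stackOn_append_replicate_nil _ 13]
    rfl
  have h1 : Does Q 15 ones (s.store fun _ => [])
      (Regs.store {s with O := List.replicate (2 ^ n) true} fun _ => []) :=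
    does_ones (by simp [s]) rfl rfl rfl hQ
  have h2 : Does Q 6 (copy rO rW rS)
      (Regs.store {s with O := List.replicate (2 ^ n) true} fun _ => [])
      (Regs.store {s with
        O := List.replicate (2 ^ n) true,
        W := List.ofFn fun _ : Fin (2 ^ n) => true} fun _ => []) :=
    (does_copy (by decide) (by decide) (by decide) rfl (by simpa using hQ)).to
      (by simp [s, List.ofFn_const])
  have h3 := does_loop_foldl (Q := Q) (x := rT) (p := atomStep) (i := 25)
    (fun (E : Fin (2 ^ n) → Bool) (l : List (BoolFn n)) => Regs.store {s with
      O := List.replicate (2 ^ n) true, T := (l.map BoolFn.truthTable).flatten, W := List.ofFn E}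
      fun _ => [])
    (fun E f k => E k && (f (cubePoint n k) == f y)) (List.ofFn h) (fun _ => true)
    (by simpa using hm) (by simp) (fun l₁ f l₂ _ => ⟨by simp [BoolFn.truthTable],
      (does_atomStep (y := y) f _ (l := (l₂.map BoolFn.truthTable).flatten) rfl (by simp) rfl rfl
        rfl rfl rfl rfl rfl hQ).to (by simp)⟩)
  have hfold : ∀ (l : List (BoolFn n)) (E : Fin (2 ^ n) → Bool) (k : Fin (2 ^ n)),
      l.foldl (fun E f k => E k && (f (cubePoint n k) == f y)) E k =
        (E k && l.all fun f => f (cubePoint n k) == f y) := by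
    intro l
    induction l with
    | nil => simp
    | cons f l ih => intro E k; rw [List.foldl_cons, ih, List.all_cons, Bool.and_assoc]
  set E : Fin (2 ^ n) → Bool :=
    (List.ofFn h).foldl (fun E f k => E k && (f (cubePoint n k) == f y)) fun _ => true
  have hE : ∀ k, E k = decide (∀ a, h a (cubePoint n k) = h a y) := by
    intro k
    rw [show E k = _ from hfold _ _ k, Bool.eq_iff_iff]
    simp
  have h4 := does_keepFirst (Q := Q) (ρ := fun _ => []) (s := {s with
    O := List.replicate (2 ^ n) true, T := [], W := List.ofFn E}) E rfl rfl rfl hQ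
  have h5 : Does Q 10 (select rW rX rS) (Regs.store {s with
      O := List.replicate (2 ^ n) true, T := [],
      W := List.ofFn (fun k => E k && decide (∀ k' < k, E k' = false))} fun _ => [])
      (Regs.store {s with
        X := [], O := List.replicate (2 ^ n) true, T := [],
        W := [firstInAtomFn h y]} fun _ => []) :=
    (does_select (by decide) (by decide) (by decide) _ y rfl rfl rfl hQ).to (by
      simp [hE, firstInAtomFn])
  have h6 := does_move (Q := Q) (σ := Regs.store {s with
    X := [], O := List.replicate (2 ^ n) true, T := [], W := [firstInAtomFn h y]} fun _ => [])
    (x := rW) (y := rX) (by decide) (by simp; exact Nat.one_le_two_pow.trans hQ)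
  refine ⟨_, ?_, h0 ▸ ((h1.seq (h2.seq ((h3.cast ?_ rfl).seq (h4.seq (h5.seq h6))))).mono
    (by decide))⟩
  · rfl
  · simp [s, List.map_ofFn, Function.comp_def]


/-! ### Computing the products of help functions -/

@[simp] lemma length_vecBits {N : ℕ} (v : Fin N → ZMod 2) : (vecBits v).length = N := by
  simp [vecBits]

lemma vecBits_one {N : ℕ} : vecBits (1 : Fin N → ZMod 2) = List.replicate N true := by
  simp [vecBits, List.ofFn_const]

lemma vecBits_bitToZMod {n : ℕ} (f : BoolFn n) :
    vecBits (fun k : Fin (2 ^ n) => bitToZMod (f (cubePoint n k))) = f.truthTable := by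
  simp [vecBits, truthTable_eq_ofFn]

/-- The concatenation of the bit strings of a list of vectors. -/
def listBits {N : ℕ} (l : List (Fin N → ZMod 2)) : List Bool := (l.map vecBits).flatten

@[simp] lemma listBits_nil {N : ℕ} : listBits ([] : List (Fin N → ZMod 2)) = [] := rfl

@[simp] lemma listBits_cons {N : ℕ} (v : Fin N → ZMod 2) (l : List (Fin N → ZMod 2)) :
    listBits (v :: l) = vecBits v ++ listBits l := rfl

@[simp] lemma listBits_append {N : ℕ} (l l' : List (Fin N → ZMod 2)) :
    listBits (l ++ l') = listBits l ++ listBits l' := by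
  simp [listBits]

@[simp] lemma length_listBits {N : ℕ} (l : List (Fin N → ZMod 2)) :
    (listBits l).length = l.length * N := by
  induction l with
  | nil => simp
  | cons v l ih =>
    rw [listBits_cons, List.length_append, ih, length_vecBits, List.length_cons]
    ring

lemma vecBits_append_ne_nil {N : ℕ} (hN : 0 < N) (v : Fin N → ZMod 2) (l : List Bool) :
    vecBits v ++ l ≠ [] := by
  intro h
  have := congrArg List.length h
  simp at this
  omega

/-- Remove the tops of `U` and `Z` and push their conjunction on `R`. -/
def multBit : StackProg :=
  .branch rU .skip (.push rR false) (.branch rZ .skip (.push rR false) (.push rR true)) ;;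
    .pop rU ;; .pop rZ

lemma does_multBit {a b : Bool} {u z : List Bool} (hU : s.U = a :: u) (hZ : s.Z = b :: z) :
    Does Q 4 multBit (s.store ρ)
      (Regs.store {s with U := u, Z := z, R := (a && b) :: s.R} ρ) := by
  refine (Does.seq (i := 2) (τ := Regs.store {s with R := (a && b) :: s.R} ρ) ?_
    (((does_pop rU).seq (does_pop rZ)).to (by simp [hU, hZ]))).mono (by decide)
  cases a
  · exact (Does.branch_cons hU ((does_push rR false).to (by simp))).mono (by decide)
  · refine Does.branch_cons hU (Does.branch_cons hZ ?_)
    cases b <;> exact (does_push rR _).to (by simp)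

/-- Multiply the first vector of `Z` by the vector in `V`. -/
def multBlock : StackProg := copy rV rU rS ;; .loop rU multBit

lemma does_multBlock {N : ℕ} (v w : Fin N → ZMod 2) (l : List Bool) (hV : s.V = vecBits v)
    (hZ : s.Z = vecBits w ++ l) (hU : s.U = []) (hS : s.S = []) (hQ : N ≤ Q) :
    Does Q 10 multBlock (s.store ρ)
      (Regs.store {s with Z := l, R := (vecBits (v * w)).reverse ++ s.R} ρ) := by
  have h1 : Does Q 6 (copy rV rU rS) (s.store ρ) (Regs.store {s with U := vecBits v} ρ) :=
    (does_copy (by decide) (by decide) (by decide) hS (by simpa [hV] using hQ)).to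
      (by simp [hV, hU])
  have h2 := does_loop_foldl (Q := Q) (x := rU) (p := multBit) (i := 4)
    (fun acc (l' : List (Bool × Bool)) => Regs.store {s with
      U := l'.map Prod.fst, Z := l'.map Prod.snd ++ l, R := acc} ρ)
    (fun acc a => (a.1 && a.2) :: acc)
    (List.ofFn fun k => (decide (v k = 1), decide (w k = 1))) s.R (by simpa using hQ) (by simp)
    (fun l₁ b l₂ _ => ⟨by simp, (does_multBit (a := b.1) (b := b.2) rfl rfl).to (by simp)⟩)
  rw [foldl_cons_map, List.map_ofFn, List.map_ofFn, List.map_ofFn] at h2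
  refine (h1.seq (h2.cast ?_ ?_)).mono (by decide)
  · simp [hZ, vecBits, Function.comp_def]
  · simp [hU, vecBits, Function.comp_def]

/-- Split off one help function from `T` and push its products with the vectors in `W` on `R`. -/
def helpStep : StackProg :=
  takeBlock ;; move rU rV ;; copy rW rZ rS ;; .loop rZ multBlock ;; clear rV

lemma does_helpStep {N : ℕ} (hN : 0 < N) (v : Fin N → ZMod 2) (ws : List (Fin N → ZMod 2))
    (l : List Bool) (hT : s.T = vecBits v ++ l) (hO : s.O = List.replicate N true)
    (hW : s.W = listBits ws) (hU : s.U = []) (hV : s.V = []) (hZ : s.Z = []) (hC : s.C = [])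
    (hS : s.S = []) (hNQ : N ≤ Q) (hQ : ws.length * N ≤ Q) :
    Does Q 20 helpStep (s.store ρ) (Regs.store {s with
      T := l, R := (listBits (ws.map (v * ·))).reverse ++ s.R} ρ) := by
  have hws : ws.length ≤ Q := (Nat.le_mul_of_pos_right _ hN).trans hQ
  have h1 : Does Q 10 takeBlock (s.store ρ)
      (Regs.store {s with T := l, U := (vecBits v).reverse} ρ) :=
    (does_takeBlock _ l hT (by simpa using hO) hC hS (by simpa using hNQ)).to (by simp [hU])
  have h2 : Does Q 4 (move rU rV) (Regs.store {s with T := l, U := (vecBits v).reverse} ρ)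
      (Regs.store {s with T := l, U := [], V := vecBits v} ρ) :=
    (does_move (by decide) (by simpa using hNQ)).to (by simp [hV])
  have h3 : Does Q 6 (copy rW rZ rS) (Regs.store {s with T := l, U := [], V := vecBits v} ρ)
      (Regs.store {s with T := l, U := [], V := vecBits v, Z := listBits ws} ρ) :=
    (does_copy (by decide) (by decide) (by decide) hS (by simpa [hW] using hQ)).to
      (by simp [hW, hZ])
  have h4 := does_loop_foldl (Q := Q) (x := rZ) (p := multBlock) (i := 10)
    (fun acc (l' : List (Fin N → ZMod 2)) => Regs.store {s with
      T := l, U := [], V := vecBits v, Z := listBits l', R := acc} ρ)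
    (fun acc w => (vecBits (v * w)).reverse ++ acc) ws s.R hws (by simp)
    (fun l₁ w l₂ _ => ⟨vecBits_append_ne_nil hN w _,
      (does_multBlock
        (s := {s with T := l, U := [], V := vecBits v, Z := listBits (w :: l₂), R := _})
        v w (listBits l₂) rfl rfl rfl hS hNQ).to (by simp)⟩)
  have hfold : ∀ (ws : List (Fin N → ZMod 2)) (acc : List Bool),
      ws.foldl (fun acc w => (vecBits (v * w)).reverse ++ acc) acc =
        (listBits (ws.map (v * ·))).reverse ++ acc := by
    intro ws
    induction ws with
    | nil => simp
    | cons w ws ih => intro acc; simp [ih]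
  rw [hfold] at h4
  refine (h1.seq (h2.seq (h3.seq (h4.seq ((does_clear ?_).to ?_))))).mono (by decide)
  · simpa using hNQ
  · simp [hU, hV, hZ]

/-- Extend the list of vectors in `W` by their products with the help functions in `B`. -/
def productStep : StackProg :=
  copy rB rT rS ;; copy rW rV rS ;; move rV rR ;; .loop rT helpStep ;; clear rW ;; move rR rW

lemma does_productStep {N : ℕ} (hN : 0 < N) (hs ws : List (Fin N → ZMod 2))
    (hB : s.B = listBits hs) (hO : s.O = List.replicate N true) (hW : s.W = listBits ws)
    (hT : s.T = []) (hU : s.U = []) (hV : s.V = []) (hZ : s.Z = []) (hC : s.C = [])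
    (hS : s.S = []) (hR : s.R = []) (hNQ : N ≤ Q) (hhsQ : hs.length * N ≤ Q)
    (hQ : ws.length * (hs.length + 1) * N ≤ Q) :
    Does Q 30 productStep (s.store ρ) (Regs.store {s with
      W := listBits (ws ++ hs.flatMap fun h => ws.map (h * ·))} ρ) := by
  have hwsQ : ws.length * N ≤ Q :=
    (Nat.mul_le_mul_right _ (Nat.le_mul_of_pos_right _ (Nat.succ_pos _))).trans hQ
  have hhs : hs.length ≤ Q := (Nat.le_mul_of_pos_right _ hN).trans hhsQ
  have h1 : Does Q 6 (copy rB rT rS) (s.store ρ) (Regs.store {s with T := listBits hs} ρ) :=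
    (does_copy (by decide) (by decide) (by decide) hS (by simpa [hB] using hhsQ)).to
      (by simp [hB, hT])
  have h2 : Does Q 6 (copy rW rV rS) (Regs.store {s with T := listBits hs} ρ)
      (Regs.store {s with T := listBits hs, V := listBits ws} ρ) :=
    (does_copy (by decide) (by decide) (by decide) hS (by simpa [hW] using hwsQ)).to
      (by simp [hW, hV])
  have h3 : Does Q 4 (move rV rR) (Regs.store {s with T := listBits hs, V := listBits ws} ρ)
      (Regs.store {s with T := listBits hs, R := (listBits ws).reverse} ρ) :=
    (does_move (by decide) (by simpa using hwsQ)).to (by simp [hV, hR])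
  have h4 := does_loop_foldl (Q := Q) (x := rT) (p := helpStep) (i := 20)
    (fun acc (l' : List (Fin N → ZMod 2)) => Regs.store {s with T := listBits l', R := acc} ρ)
    (fun acc h => (listBits (ws.map (h * ·))).reverse ++ acc) hs (listBits ws).reverse hhs (by simp)
    (fun l₁ w l₂ _ => ⟨vecBits_append_ne_nil hN w _,
      (does_helpStep (s := {s with T := listBits (w :: l₂), R := _}) hN w ws (listBits l₂) rfl
        hO hW hU hV hZ hC hS hNQ hwsQ).to (by simp)⟩)
  have hfold : ∀ (hs : List (Fin N → ZMod 2)) (acc : List Bool),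
      hs.foldl (fun acc h => (listBits (ws.map (h * ·))).reverse ++ acc) acc =
        (listBits (hs.flatMap fun h => ws.map (h * ·))).reverse ++ acc := by
    intro hs
    induction hs with
    | nil => simp
    | cons h hs ih => intro acc; simp [ih]
  rw [hfold, ← List.reverse_append, ← listBits_append] at h4
  set new := ws ++ hs.flatMap fun h => ws.map (h * ·) with hnew
  have hlen : new.length * N ≤ Q := by
    have : new.length = ws.length * (hs.length + 1) := by
      simp [hnew, List.length_flatMap]; ring
    rwa [this]
  have h5 : Does Q 4 (clear rW)
      (Regs.store {s with T := [], R := (listBits new).reverse} ρ)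
      (Regs.store {s with T := [], W := [], R := (listBits new).reverse} ρ) :=
    (does_clear (by simpa [hW] using hwsQ)).to (by simp)
  have h6 : Does Q 4 (move rR rW)
      (Regs.store {s with T := [], W := [], R := (listBits new).reverse} ρ)
      (Regs.store {s with W := listBits new} ρ) :=
    (does_move (by decide) (by simpa using hlen)).to (by simp [hR, hT])
  exact (h1.seq (h2.seq (h3.seq (h4.seq (h5.seq h6))))).mono (by decide)

/-- Put in `W` all products of `k` factors from `1` and the help functions in `B`, where `k` is the
length of `D`. -/
def products : StackProg := copy rO rW rS ;; forBits rD fun _ => productStep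

lemma does_products {N k : ℕ} (hN : 0 < N) (hs : List (Fin N → ZMod 2))
    (hB : s.B = listBits hs) (hO : s.O = List.replicate N true) (hD : s.D = List.replicate k true)
    (hW : s.W = []) (hT : s.T = []) (hU : s.U = []) (hV : s.V = []) (hZ : s.Z = [])
    (hC : s.C = []) (hS : s.S = []) (hR : s.R = []) (hkQ : k ≤ Q) (hhsQ : hs.length * N ≤ Q)
    (hQ : (hs.length + 1) ^ k * N ≤ Q) :
    Does Q 40 products (s.store ρ) (Regs.store {s with
      W := listBits (productList hs k), D := []} ρ) := by
  have hNQ : N ≤ Q := (Nat.le_mul_of_pos_left _ (Nat.pow_pos (Nat.succ_pos _))).trans hQ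
  have h1 : Does Q 6 (copy rO rW rS) (s.store ρ)
      (Regs.store {s with W := listBits (productList hs 0)} ρ) :=
    (does_copy (by decide) (by decide) (by decide) hS (by simpa [hO] using hNQ)).to
      (by simp [hO, hW, productList, vecBits_one])
  have h2 := does_forBits (Q := Q) (x := rD) (P := fun _ => productStep) (i := 30)
    (fun (a : ℕ) l => Regs.store {s with W := listBits (productList hs a), D := l} ρ)
    (fun a _ => a + 1) (List.replicate k true) 0 (by simpa using hkQ) (by simp)
    (fun l₁ b l₂ hl => by
      have hlen : l₁.length < k := by
        have := congrArg List.length hl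
        simp at this
        omega
      have hfold : l₁.foldl (fun a _ => a + 1) 0 = l₁.length := by simp
      rw [hfold]
      refine (does_productStep (s := {s with W := listBits (productList hs l₁.length), D := l₂})
        hN hs (productList hs l₁.length) hB hO rfl hT hU hV hZ hC hS hR hNQ hhsQ ?_).cast
        (by simp) rfl
      rw [length_productList, ← pow_succ]
      exact (Nat.mul_le_mul_right _ (Nat.pow_le_pow_right (Nat.succ_pos _) hlen)).trans hQ)
  refine (h1.seq (h2.cast ?_ ?_)).mono (by decide)
  · simp [hD]
  · simp

/-! ### Computing the number of factors -/

/-- Replace a unary number in `C` by its half, rounded down. -/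
def halveUnary : StackProg :=
  .loop rC (.pop rC ;; .branch rC .skip (.push rS true ;; .pop rC) (.push rS true ;; .pop rC)) ;;
    move rS rC

lemma does_halveUnary {k : ℕ} (hC : s.C = List.replicate k true) (hS : s.S = []) (hk : k ≤ Q) :
    Does Q 10 halveUnary (s.store ρ)
      (Regs.store {s with C := List.replicate (k / 2) true} ρ) := by
  have h1 := does_loop (Q := Q) (x := rC) (i := 3) (k := (k + 1) / 2)
    (p := .pop rC ;; .branch rC .skip (.push rS true ;; .pop rC) (.push rS true ;; .pop rC))
    (by omega) (fun a => Regs.store {s with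
      C := List.replicate (k - 2 * a) true, S := List.replicate (min a (k / 2)) true} ρ)
    (fun a ha => by
      refine ⟨by simp; omega, ?_⟩
      have hpop : Does Q 0 (.pop rC) (Regs.store {s with
          C := List.replicate (k - 2 * a) true, S := List.replicate (min a (k / 2)) true} ρ)
          (Regs.store {s with
            C := List.replicate (k - 2 * a - 1) true,
            S := List.replicate (min a (k / 2)) true} ρ) :=
        (does_pop rC).to (by simp)
      refine (hpop.seq (j := 2) ?_).mono (by decide)
      obtain hlast | ⟨c, hc⟩ : k = 2 * a + 1 ∨ ∃ c, k = 2 * a + (c + 2) := by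
        rcases Nat.lt_or_ge k (2 * a + 2) with h | h
        · left; omega
        · exact Or.inr ⟨k - (2 * a + 2), by omega⟩
      · have e1 : k - 2 * a - 1 = 0 := by omega
        have e2 : k - 2 * (a + 1) = 0 := by omega
        have e3 : min a (k / 2) = min (a + 1) (k / 2) := by omega
        rw [e1, e2, e3]
        exact (Does.branch_nil (by simp) does_skip).mono (by decide)
      · have e1 : k - 2 * a - 1 = c + 1 := by omega
        have e2 : k - 2 * (a + 1) = c := by omega
        have e3 : min a (k / 2) = a := by omega
        have e4 : min (a + 1) (k / 2) = a + 1 := by omega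
        rw [e1, e2, e3, e4]
        refine Does.branch_cons (b := true) (l := List.replicate c true) rfl ?_
        exact ((does_push rS true).seq (does_pop rC)).to (by simp [List.replicate_succ]))
    (by simp; omega)
  refine ((h1.cast ?_ rfl).seq ((does_move (by decide) ?_).to ?_)).mono (by decide)
  · cases s
    simp_all
  · simp; omega
  · have e1 : k - 2 * ((k + 1) / 2) = 0 := by omega
    have e2 : min ((k + 1) / 2) (k / 2) = k / 2 := by omega
    simp [e1, e2, hS]

/-- Put in `In₀` the number of coordinates of the point in `X`, in unary. -/
def unaryLength : StackProg := copy rX rC rS ;; forBits rC fun _ => .push rIn₀ true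

lemma does_unaryLength {n : ℕ} (hX : s.X.length = n) (hC : s.C = []) (hS : s.S = [])
    (hI : s.In₀ = []) (hn : n ≤ Q) :
    Does Q 10 unaryLength (s.store ρ)
      (Regs.store {s with In₀ := List.replicate n true} ρ) := by
  have h1 : Does Q 6 (copy rX rC rS) (s.store ρ) (Regs.store {s with C := s.X} ρ) :=
    (does_copy (by decide) (by decide) (by decide) (by simpa using hS)
      (by simpa [hX] using hn)).to (by simp [hC])
  have h2 := does_forBits (Q := Q) (x := rC) (P := fun _ => .push rIn₀ true) (i := 0)
    (fun (a : ℕ) l => Regs.store {s with C := l, In₀ := List.replicate a true} ρ)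
    (fun a _ => a + 1) s.X 0 (by omega) (by simp)
    (fun l₁ b l₂ _ => (does_push _ _).to (by simp [List.replicate_succ]))
  refine (h1.seq (h2.cast ?_ ?_)).mono (by decide)
  · simp [hI]
  · simp [hC, hX]

/-- Put in `L` the number of binary digits of the number in `In₀`. -/
def unaryLog : StackProg := copy rIn₀ rC rS ;; .loop rC (halveUnary ;; .push rL true)

lemma does_unaryLog {n : ℕ} (hn : 0 < n) (hI : s.In₀ = List.replicate n true) (hC : s.C = [])
    (hS : s.S = []) (hL : s.L = []) (hQ : n ≤ Q) :
    Does Q 20 unaryLog (s.store ρ)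
      (Regs.store {s with L := List.replicate (Nat.log 2 n + 1) true} ρ) := by
  have h1 : Does Q 6 (copy rIn₀ rC rS) (s.store ρ)
      (Regs.store {s with C := List.replicate n true} ρ) :=
    (does_copy (by decide) (by decide) (by decide) hS (by simpa [hI] using hQ)).to
      (by simp [hI, hC])
  have h2 := does_loop (Q := Q) (x := rC) (i := 11) (k := Nat.log 2 n + 1)
    (p := halveUnary ;; .push rL true)
    ((Nat.succ_le_of_lt (Nat.log_lt_of_lt_pow hn.ne' Nat.lt_two_pow_self)).trans hQ)
    (fun a => Regs.store {s with
      C := List.replicate (n / 2 ^ a) true, L := List.replicate a true} ρ)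
    (fun a ha => by
      constructor
      · have : 2 ^ a ≤ n := Nat.pow_le_of_le_log hn.ne' (Nat.lt_succ_iff.1 ha)
        simpa using Nat.not_lt.2 this
      · refine ((does_halveUnary (s := {s with
          C := List.replicate (n / 2 ^ a) true, L := List.replicate a true}) rfl hS
          ((Nat.div_le_self _ _).trans hQ)).seq
          ((does_push rL true).to ?_)).mono (by decide)
        simp [Nat.div_div_eq_div_mul, pow_succ, List.replicate_succ])
    (by
      have : n < 2 ^ (Nat.log 2 n + 1) := Nat.lt_pow_succ_log_self one_lt_two n
      simpa using this)
  refine (h1.seq (h2.cast ?_ ?_)).mono (by decide)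
  · simp [hL]
  · have : n / 2 ^ (Nat.log 2 n + 1) = 0 :=
      Nat.div_eq_of_lt (Nat.lt_pow_succ_log_self one_lt_two n)
    simp [this, hC]

/-- Put in `D` the `e`-th power of the number in `L`. -/
def unaryPow : ℕ → StackProg
  | 0 => .push rD true
  | e + 1 => unaryPow e ;; forBits rD (fun _ => copy rL rU rS) ;; move rU rD

lemma does_unaryPow {b : ℕ} (e : ℕ) (hL : s.L = List.replicate b true) (hU : s.U = [])
    (hS : s.S = []) (hD : s.D = []) (hb : 0 < b) (hQ : b ^ e ≤ Q) :
    Does Q (15 + e) (unaryPow e) (s.store ρ)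
      (Regs.store {s with D := List.replicate (b ^ e) true} ρ) := by
  induction e with
  | zero => exact ((does_push rD true).to (by simp [hD])).mono (Nat.zero_le _)
  | succ e ih =>
    have hbe : b ^ e ≤ b ^ (e + 1) := Nat.pow_le_pow_right hb (Nat.le_succ _)
    have hb1 : b ≤ Q := (Nat.le_self_pow (Nat.succ_ne_zero e) b).trans hQ
    have h2 := does_forBits (Q := Q) (x := rD) (P := fun _ => copy rL rU rS) (i := 6)
      (fun (a : ℕ) l => Regs.store {s with D := l, U := List.replicate (b * a) true} ρ)
      (fun a _ => a + 1) (List.replicate (b ^ e) true) 0 (by simpa using hbe.trans hQ) (by simp)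
      (fun l₁ c l₂ _ => (does_copy (by decide) (by decide) (by decide) hS
        (by simpa [hL] using hb1)).to (by simp [hL, mul_add, add_comm]))
    have h3 : Does Q 4 (move rU rD)
        (Regs.store {s with D := [], U := List.replicate (b ^ (e + 1)) true} ρ)
        (Regs.store {s with D := List.replicate (b ^ (e + 1)) true} ρ) :=
      (does_move (by decide) (by simpa using hQ)).to (by simp [hU])
    refine ((ih (hbe.trans hQ)).seq ((h2.cast ?_ ?_).seq h3)).mono ?_
    · simp [hU]
    · simp [pow_succ']
    · omega

/-! ### The value of a remote point -/

/-- Run `p` on the list of products of help functions, and output the coordinate of its result at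
the point in `X`. -/
def remoteCoordinate (e : ℕ) (p : StackProg) : StackProg :=
  ones ;; copy rT rB rS ;; clear rT ;; unaryLength ;; unaryLog ;; unaryPow e ;; products ;;
    copy rW rIn₁ rS ;; p.shift rIn₀ ;; move rIn₀ rU ;; move rU rV ;; select rV rX rS ;; move rV rX

lemma listBits_helpVectors {n m : ℕ} (h : Fin m → BoolFn n) :
    listBits (helpVectors h) = (List.ofFn fun a => (h a).truthTable).flatten := by
  rw [listBits, helpVectors, List.map_ofFn]
  simp only [Function.comp_def, vecBits_bitToZMod]

lemma does_remoteCoordinate {n m e : ℕ} {p : StackProg} (hn : 0 < n) (h : Fin m → BoolFn n)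
    (y : Fin n → Bool) (v : Fin (2 ^ n) → ZMod 2) (hnQ : 2 ^ n ≤ Q) (hmQ : m * 2 ^ n ≤ Q)
    (heQ : (Nat.log 2 n + 1) ^ e ≤ Q) (hQ : (m + 1) ^ (Nat.log 2 n + 1) ^ e * 2 ^ n ≤ Q)
    (hp : p.OutputsWithin [List.replicate n true,
      listBits (productList (helpVectors h) ((Nat.log 2 n + 1) ^ e))] (vecBits v) Q)
    (hX : s.X = List.ofFn y) (hT : s.T = listBits (helpVectors h))
    (hO : s.O = []) (hW : s.W = []) (hU : s.U = []) (hV : s.V = []) (hZ : s.Z = [])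
    (hC : s.C = []) (hS : s.S = []) (hB : s.B = []) (hR : s.R = []) (hD : s.D = [])
    (hL : s.L = []) (hI₀ : s.In₀ = []) (hI₁ : s.In₁ = []) :
    ∃ τ, τ 0 = [decide (v (cubeIndex y) = 1)] ∧
      Does Q (60 + e) (remoteCoordinate e p) (s.store fun _ => []) τ := by
  have hn' : n ≤ Q := Nat.lt_two_pow_self.le.trans hnQ
  have hN : 0 < 2 ^ n := Nat.two_pow_pos n
  have hlen : (helpVectors h).length = m := by simp [helpVectors]
  set D := (Nat.log 2 n + 1) ^ e
  let ρ : Store := fun _ => []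
  have h1 : Does Q 15 ones (s.store ρ)
      (Regs.store {s with O := List.replicate (2 ^ n) true} ρ) :=
    does_ones (by simp [hX]) hO hC hS hnQ
  have h2 : Does Q 6 (copy rT rB rS) (Regs.store {s with O := List.replicate (2 ^ n) true} ρ)
      (Regs.store {s with O := List.replicate (2 ^ n) true, B := listBits (helpVectors h)} ρ) :=
    (does_copy (by decide) (by decide) (by decide) hS (by simpa [hT, hlen] using hmQ)).to
      (by simp [hT, hB])
  have h3 : Does Q 4 (clear rT)
      (Regs.store {s with O := List.replicate (2 ^ n) true, B := listBits (helpVectors h)} ρ)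
      (Regs.store {s with
        O := List.replicate (2 ^ n) true, B := listBits (helpVectors h), T := []} ρ) :=
    (does_clear (by simpa [hT, hlen] using hmQ)).to (by simp)
  have h4 := does_unaryLength (Q := Q) (ρ := ρ) (n := n) (s := {s with
    O := List.replicate (2 ^ n) true, B := listBits (helpVectors h), T := []})
    (by simp [hX]) hC hS hI₀ hn'
  have h5 := does_unaryLog (Q := Q) (ρ := ρ) (s := {s with
    O := List.replicate (2 ^ n) true, B := listBits (helpVectors h), T := [],
    In₀ := List.replicate n true}) hn rfl hC hS hL hn'
  have h6 := does_unaryPow (Q := Q) (ρ := ρ) (s := {s with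
    O := List.replicate (2 ^ n) true, B := listBits (helpVectors h), T := [],
    In₀ := List.replicate n true, L := List.replicate (Nat.log 2 n + 1) true})
    e rfl hU hS hD (Nat.succ_pos _) heQ
  have h7 := does_products (Q := Q) (ρ := ρ) (k := D) (s := {s with
    O := List.replicate (2 ^ n) true, B := listBits (helpVectors h), T := [],
    In₀ := List.replicate n true, L := List.replicate (Nat.log 2 n + 1) true,
    D := List.replicate D true}) hN (helpVectors h) rfl rfl rfl hW rfl hU hV hZ hC hS hR
    heQ (by rwa [hlen]) (by rwa [hlen])
  let s' : Regs := {s with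
    O := List.replicate (2 ^ n) true, B := listBits (helpVectors h), T := [],
    L := List.replicate (Nat.log 2 n + 1) true, D := [],
    W := listBits (productList (helpVectors h) D)}
  have h8 : Does Q 6 (copy rW rIn₁ rS) (Regs.store {s' with In₀ := List.replicate n true} ρ)
      (Regs.store {s' with
        In₀ := List.replicate n true, In₁ := listBits (productList (helpVectors h) D)} ρ) :=
    (does_copy (by decide) (by decide) (by decide) hS
      (by simpa [s', length_productList, hlen] using hQ)).to (by simp [s', hI₁])
  obtain ⟨t, ht, τ, hrun, hτ⟩ := hp
  -- The stacks of the shifted program start at `In₀`, and hold its two inputs.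
  have h9 : Does Q 1 (p.shift rIn₀) (Regs.store {s' with
        In₀ := List.replicate n true, In₁ := listBits (productList (helpVectors h) D)} ρ)
      (Regs.store {s' with In₀ := vecBits v, In₁ := τ 1} fun i => τ (i + 2)) := by
    refine ⟨t, by rw [pow_one]; omega, ?_⟩
    have := hrun.shift (K := rIn₀) (l := [s'.X, s'.T, s'.O, s'.W, s'.U, s'.V, s'.Z, s'.C, s'.S,
      s'.B, s'.R, s'.D, s'.L]) rfl
    rw [load_eq_stackOn, show τ = stackOn [vecBits v, τ 1] fun i => τ (i + 2) by
      funext i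
      rcases i with _ | _ | i
      · exact hτ
      · rfl
      · rfl, ← stackOn_append, ← stackOn_append] at this
    exact this
  generalize (fun i => τ (i + 2)) = ρ' at h9
  have h10 : Does Q 4 (move rIn₀ rU) (Regs.store {s' with In₀ := vecBits v, In₁ := τ 1} ρ')
      (Regs.store {s' with U := (vecBits v).reverse, In₀ := [], In₁ := τ 1} ρ') :=
    (does_move (by decide) (by simpa using hnQ)).to (by simp [s', hU])
  have h11 : Does Q 4 (move rU rV)
      (Regs.store {s' with U := (vecBits v).reverse, In₀ := [], In₁ := τ 1} ρ')
      (Regs.store {s' with U := [], V := vecBits v, In₀ := [], In₁ := τ 1} ρ') :=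
    (does_move (by decide) (by simpa using hnQ)).to (by simp [s', hV])
  have h12 : Does Q 10 (select rV rX rS)
      (Regs.store {s' with U := [], V := vecBits v, In₀ := [], In₁ := τ 1} ρ')
      (Regs.store {s' with
        X := [], U := [], V := [decide (v (cubeIndex y) = 1)], In₀ := [], In₁ := τ 1} ρ') :=
    (does_select (by decide) (by decide) (by decide) (fun k => decide (v k = 1)) y rfl hX hS
      hnQ).to (by simp)
  have h13 := does_move (Q := Q) (x := rV) (y := rX) (σ := Regs.store {s' with
      X := [], U := [], V := [decide (v (cubeIndex y) = 1)], In₀ := [], In₁ := τ 1} ρ')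
    (by decide) (by simp; omega)
  exact ⟨_, rfl, (h1.seq (h2.seq (h3.seq (h4.seq (h5.seq (h6.seq (h7.seq (h8.seq (h9.seq
    (h10.seq (h11.seq (h12.seq h13)))))))))))).mono (by omega)⟩

/-- Run `p` if `C` contains at least `k` bits, and output `false` otherwise. -/
def ifLengthGE (p : StackProg) : ℕ → StackProg
  | 0 => clear rC ;; p
  | k + 1 => .branch rC (clear rX ;; .push rX false) (.pop rC ;; ifLengthGE p k)
      (.pop rC ;; ifLengthGE p k)

lemma does_ifLengthGE_of_lt {p : StackProg} {k : ℕ} (hk : s.C.length < k) (hX : s.X.length ≤ Q) :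
    Does Q (10 + 2 * k) (ifLengthGE p k) (s.store ρ)
      (Regs.store {s with X := [false], C := []} ρ) := by
  induction k generalizing s with
  | zero => omega
  | succ k ih =>
    match hC : s.C with
    | [] =>
      refine (Does.branch_nil hC ((does_clear hX).seq ((does_push rX false).to ?_))).mono
        (by omega)
      simp [hC]
    | b :: l =>
      rw [hC, List.length_cons] at hk
      have := (does_pop (Q := Q) (σ := s.store ρ) rC).seq
        ((ih (s := {s with C := l}) (by simp; omega) hX).cast (by simp [hC]) rfl)
      refine (Does.branch_cons hC (i := 11 + 2 * k) ?_).mono (by omega)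
      cases b <;> exact this.mono (by omega)

lemma does_ifLengthGE_of_le {p : StackProg} {k : ℕ} {τ : Store} (hk : k ≤ s.C.length)
    (hC : s.C.length ≤ Q) (hp : Does Q j p (Regs.store {s with C := []} ρ) τ) :
    Does Q (5 + j + 2 * k) (ifLengthGE p k) (s.store ρ) τ := by
  induction k generalizing s with
  | zero => exact (((does_clear hC).to (by simp)).seq hp).mono (by omega)
  | succ k ih =>
    match hl : s.C with
    | [] => rw [hl] at hk; simp at hk
    | b :: l =>
      rw [hl, List.length_cons] at hk hC
      have := (does_pop (Q := Q) (σ := s.store ρ) rC).seq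
        ((ih (s := {s with C := l}) (by simpa using hk) (by simp; omega) hp).cast
          (by simp [hl]) rfl)
      refine (Does.branch_cons hl (i := 6 + j + 2 * k) ?_).mono (by omega)
      cases b <;> exact this.mono (by omega)

end StackProg

/-! ### Explicit functions -/

lemma StackProg.Does.outputsWithin {Q j : ℕ} {p : StackProg} {l : List (List Bool)}
    {out : List Bool} {τ : StackProg.Store} (h : StackProg.Does Q j p (StackProg.load l) τ)
    (hτ : τ 0 = out) : p.OutputsWithin l out ((Q + 2) ^ j) := by
  obtain ⟨t, ht, hr⟩ := h
  exact ⟨t, ht, τ, hr, hτ⟩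

lemma StackProg.OutputsWithin.mono {p : StackProg} {l : List (List Bool)} {out : List Bool}
    {T T' : ℕ} (h : p.OutputsWithin l out T) (hT : T ≤ T') : p.OutputsWithin l out T' := by
  obtain ⟨t, ht, hr⟩ := h
  exact ⟨t, ht.trans hT, hr⟩

/-- A power of a bound of the form `2 ^ (n ^ O(1))` has this form again. -/
lemma exists_add_two_pow_le (A j : ℕ) :
    ∃ a : ℕ, ∀ n : ℕ, 0 < n → (2 ^ (A * n ^ A + A) + 2) ^ j ≤ 2 ^ (a * n ^ a + a) := by
  refine ⟨(j + 1) * (A + 2), fun n hn => ?_⟩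
  have h1 : 2 ^ (A * n ^ A + A) + 2 ≤ 2 ^ (A * n ^ A + A + 2) := by
    have : 1 ≤ 2 ^ (A * n ^ A + A) := Nat.one_le_two_pow
    rw [pow_add 2 _ 2]
    omega
  refine (Nat.pow_le_pow_left h1 j).trans ?_
  rw [← pow_mul]
  refine Nat.pow_le_pow_right two_pos ?_
  have h2 : n ^ A ≤ n ^ ((j + 1) * (A + 2)) := Nat.pow_le_pow_right hn (by nlinarith)
  have h3 : A * n ^ A ≤ (A + 2) * n ^ ((j + 1) * (A + 2)) := Nat.mul_le_mul (by omega) h2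
  calc (A * n ^ A + A + 2) * j
      ≤ ((A + 2) * n ^ ((j + 1) * (A + 2)) + (A + 2)) * (j + 1) :=
        Nat.mul_le_mul (by omega) (by omega)
    _ = _ := by ring

lemma pow_le_mul_pow_add {A b n : ℕ} (hn : 0 < n) (hb : b ≤ A) (hA : 0 < A) :
    n ^ b ≤ A * n ^ A + A :=
  (Nat.pow_le_pow_right hn hb).trans ((Nat.le_mul_of_pos_left _ hA).trans (Nat.le_add_right _ _))

/-- With fewer than `n` help functions, a function that separates two points with the same values
of the help functions is explicit. -/
lemma explicitGivenHelp_firstInAtomFn {c : ℝ} (hc : 0 < c) :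
    ExplicitGivenHelp (fun n => (2 : ℝ) ^ (Real.logb 2 (n : ℝ) ^ c))
      fun _ _ h => firstInAtomFn h := by
  obtain ⟨b, hb⟩ := exists_two_rpow_le_two_pow hc
  obtain ⟨a, ha⟩ := exists_add_two_pow_le (b + 1) 35
  refine ⟨StackProg.firstInAtom, a, fun n hn m hm h y => ?_⟩
  have hm' : m ≤ 2 ^ n ^ b := by exact_mod_cast hm.trans (hb n hn)
  obtain ⟨τ, hτ, hrun⟩ := StackProg.does_firstInAtom (Q := 2 ^ ((b + 1) * n ^ (b + 1) + (b + 1)))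
    h y (Nat.pow_le_pow_right two_pos (by
      simpa using pow_le_mul_pow_add hn (Nat.le_add_left 1 b) (Nat.succ_pos b)))
    (hm'.trans (Nat.pow_le_pow_right two_pos
      (pow_le_mul_pow_add hn (Nat.le_succ b) (Nat.succ_pos b))))
  exact (hrun.outputsWithin hτ).mono (ha n hn)

namespace StackProg

/-- Output a coordinate of a remote point if the input point has at least `n₀` coordinates, and
`false` otherwise. -/
def remoteFunction (e n₀ : ℕ) (p : StackProg) : StackProg :=
  copy rX rC rS ;; ifLengthGE (remoteCoordinate e p) n₀

variable {Q n m : ℕ} {e n₀ : ℕ} {p : StackProg} (h : Fin m → BoolFn n) (y : Fin n → Bool)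

/-- The registers at the start. -/
def initRegs : Regs := ⟨List.ofFn y, listBits (helpVectors h),
  [], [], [], [], [], [], [], [], [], [], [], [], []⟩

lemma load_eq_initRegs_store :
    load [List.ofFn y, (List.ofFn fun a => (h a).truthTable).flatten] =
      (initRegs h y).store fun _ => [] := by
  rw [load_eq_stackOn, ← stackOn_append_replicate_nil _ 13, ← listBits_helpVectors]
  rfl

lemma does_copy_initRegs (hnQ : n ≤ Q) :
    Does Q 6 (copy rX rC rS) ((initRegs h y).store fun _ => [])
      (Regs.store {initRegs h y with C := List.ofFn y} fun _ => []) :=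
  (does_copy (by decide) (by decide) (by decide) rfl (by simpa [initRegs] using hnQ)).to
    (by simp [initRegs])

lemma outputsWithin_remoteFunction_of_lt (hn : n < n₀) (hnQ : n ≤ Q) :
    (remoteFunction e n₀ p).OutputsWithin
      [List.ofFn y, (List.ofFn fun a => (h a).truthTable).flatten] [false]
      ((Q + 2) ^ (11 + 2 * n₀)) := by
  refine Does.outputsWithin (τ := Regs.store {initRegs h y with X := [false], C := []} fun _ => [])
    ?_ rfl
  rw [load_eq_initRegs_store]
  exact ((does_copy_initRegs h y hnQ).seq (does_ifLengthGE_of_lt (by simpa using hn)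
    (by simpa [initRegs] using hnQ))).mono (by omega)

lemma outputsWithin_remoteFunction_of_le (hn₀ : n₀ ≤ n) (hn : 0 < n) (v : Fin (2 ^ n) → ZMod 2)
    (hnQ : 2 ^ n ≤ Q) (hmQ : m * 2 ^ n ≤ Q) (heQ : (Nat.log 2 n + 1) ^ e ≤ Q)
    (hQ : (m + 1) ^ (Nat.log 2 n + 1) ^ e * 2 ^ n ≤ Q)
    (hp : p.OutputsWithin [List.replicate n true,
      listBits (productList (helpVectors h) ((Nat.log 2 n + 1) ^ e))] (vecBits v) Q) :
    (remoteFunction e n₀ p).OutputsWithin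
      [List.ofFn y, (List.ofFn fun a => (h a).truthTable).flatten]
      [decide (v (cubeIndex y) = 1)] ((Q + 2) ^ (66 + e + 2 * n₀)) := by
  have hn' : n ≤ Q := Nat.lt_two_pow_self.le.trans hnQ
  obtain ⟨τ, hτ, hrun⟩ := does_remoteCoordinate (s := initRegs h y) hn h y v hnQ hmQ heQ hQ hp
    rfl rfl rfl rfl rfl rfl rfl rfl rfl rfl rfl rfl rfl rfl rfl
  refine Does.outputsWithin (τ := τ) ?_ hτ
  rw [load_eq_initRegs_store]
  exact ((does_copy_initRegs h y hn').seq (does_ifLengthGE_of_le (by simpa using hn₀)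
    (by simpa using hn') hrun)).mono (by omega)

end StackProg

/-- A point that is remote from the polynomials of degree at most `l ^ d` in the help functions is,
as a function on the cube, not computed by a small circuit of depth `d`. -/
lemma not_mem_sizeDepth_of_isRemote {n m s d l : ℕ} (h : Fin m → BoolFn n) {r : ℝ} (hl : 0 < l)
    (hs : (s : ℝ) * 2 ^ n < r * 2 ^ l) {P : Submodule (ZMod 2) (Fin (2 ^ n) → ZMod 2)}
    (hP : helpSpan (fun a (k : Fin (2 ^ n)) => h a (cubePoint n k)) ^ l ^ d ≤ P)
    {v : Fin (2 ^ n) → ZMod 2} (hv : IsRemote P r v) :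
    (fun y => decide (v (cubeIndex y) = 1)) ∉ SizeDepth h s d := by
  rintro ⟨t, ht, C, o, hd, hC⟩
  obtain ⟨q, hq, B, hB, hqB⟩ := C.exists_approx
    (fun a (k : Fin (2 ^ n)) => h a (cubePoint n k)) hl o hd
  have hdist : hammingDist q v ≤ B.card := by
    refine Finset.card_le_card fun k hk => ?_
    by_contra hkB
    refine (Finset.mem_filter.1 hk).2 ?_
    rw [hqB k hkB, ← hC]
    beta_reduce
    rw [cubeIndex_cubePoint]
    have hbit : ∀ a : ZMod 2, bitToZMod (decide (a = 1)) = a := by decide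
    exact hbit _
  have h1 : r ≤ B.card := (hv q (hP hq)).trans (by exact_mod_cast hdist)
  have h2 : (B.card : ℝ) * 2 ^ l ≤ s * 2 ^ n := by
    have : B.card * 2 ^ l ≤ s * 2 ^ n := by
      simpa using hB.trans (Nat.mul_le_mul_right _ ht)
    exact_mod_cast this
  have h3 : r * 2 ^ l ≤ B.card * 2 ^ l := by gcongr
  linarith

/-- The number of factors is chosen as the `e`-th power of the number of digits of `n`. -/
lemma exists_exponent {d : ℕ} {c₀ c₁ c₂ : ℝ} (hc₂ : 1 ≤ c₂) (hc₁ : c₂ < c₁) (hc₀ : c₁ < c₀)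
    (hc : (c₁ + 2 * c₂) * (d : ℝ) + c₂ < c₀) :
    ∃ e : ℕ, (d = 0 ∨ c₁ * d < e) ∧ e + c₂ < c₀ := by
  rcases Nat.eq_zero_or_pos d with rfl | hd
  · exact ⟨0, Or.inl rfl, by simpa using hc₁.trans hc₀⟩
  · have hd' : (1 : ℝ) ≤ d := by exact_mod_cast hd
    refine ⟨⌊c₁ * d⌋₊ + 1, Or.inr (by exact_mod_cast Nat.lt_floor_add_one _), ?_⟩
    have := Nat.floor_le (show 0 ≤ c₁ * d by nlinarith)
    push_cast
    nlinarith

theorem theorem2p3 (d : ℕ) (c₀ c₁ c₂ : ℝ) (hc₂ : 0 < c₂) (hc₁ : c₂ < c₁) (hc₀ : c₁ < c₀)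
    (hc : (c₁ + 2 * c₂) * (d : ℝ) + c₂ < c₀)
    (hRPP : RemotePointSolvable
      (fun n => (2 : ℝ) ^ (Real.logb 2 (n : ℝ) ^ c₀))
      (fun n => (2 : ℝ) ^ n / (2 : ℝ) ^ (Real.logb 2 (n : ℝ) ^ c₁))) :
    ∃ g : (n m : ℕ) → (Fin m → BoolFn n) → BoolFn n,
      ExplicitGivenHelp (fun n => (2 : ℝ) ^ (Real.logb 2 (n : ℝ) ^ c₂)) g ∧
      ∀ c : ℕ, ∀ᶠ n : ℕ in atTop,
        ∀ m : ℕ, (m : ℝ) ≤ (2 : ℝ) ^ (Real.logb 2 (n : ℝ) ^ c₂) →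
          ∀ h : Fin m → BoolFn n, g n m h ∉ SizeDepth h (c * n ^ c) d := by
  rcases lt_or_ge c₂ 1 with hsmall | hlarge
  · -- There are fewer than `n` help functions.
    refine ⟨fun _ _ h => firstInAtomFn h, explicitGivenHelp_firstInAtomFn hc₂,
      fun c => ?_⟩
    filter_upwards [eventually_two_rpow_lt_natCast hsmall] with n hn m hm h
    exact firstInAtomFn_not_mem_sizeDepth (by exact_mod_cast hm.trans_lt hn) h _ _
  obtain ⟨e, hde, hec⟩ := exists_exponent hlarge hc₁ hc₀ hc
  obtain ⟨p, a, hp⟩ := hRPP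
  obtain ⟨b, hb⟩ := exists_two_rpow_le_two_pow (hc₂.trans (hc₁.trans hc₀))
  obtain ⟨n₀, hn₀⟩ := eventually_atTop.1 ((eventually_succ_pow_le hc₂ hec).and
    ((eventually_two_rpow_le_quarter c₀).and (eventually_div_two_rpow_le (hc₂.trans hc₁))))
  set A := a + b + e + 2 with hA
  obtain ⟨a', ha'⟩ := exists_add_two_pow_le A (66 + e + 2 * n₀)
  have hsize : ∀ n : ℕ, 0 < n → 2 ^ n ≤ 2 ^ (A * n ^ A + A) := fun n hn =>
    Nat.pow_le_pow_right two_pos (by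
      simpa using pow_le_mul_pow_add (A := A) (b := 1) hn (by omega) (by omega))
  have hmain : ∀ n m : ℕ, ∀ h : Fin m → BoolFn n, ∃ G : BoolFn n,
      0 < n → (m : ℝ) ≤ (2 : ℝ) ^ (Real.logb 2 (n : ℝ) ^ c₂) →
      (∀ y, (StackProg.remoteFunction e n₀ p).OutputsWithin
        [List.ofFn y, (List.ofFn fun i => (h i).truthTable).flatten] [G y]
        (2 ^ (a' * n ^ a' + a'))) ∧
      (n₀ ≤ n → ∃ v, IsRemote (Submodule.span (ZMod 2)
          {q | q ∈ productList (helpVectors h) ((Nat.log 2 n + 1) ^ e)})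
          ((2 : ℝ) ^ n / (2 : ℝ) ^ (Real.logb 2 (n : ℝ) ^ c₁)) v ∧
        G = fun y => decide (v (cubeIndex y) = 1)) := by
    intro n m h
    rcases Nat.lt_or_ge n n₀ with hlt | hge
    · refine ⟨fun _ => false, fun hn _ => ⟨fun y => ?_, fun hle => absurd hlt (not_lt.2 hle)⟩⟩
      refine (StackProg.outputsWithin_remoteFunction_of_lt h y hlt
        (Nat.lt_two_pow_self.le.trans (hsize n hn))).mono ((Nat.pow_le_pow_right ?_ ?_).trans
          (ha' n hn))
      · positivity
      · omega
    by_cases hpos : 0 < n ∧ (m : ℝ) ≤ (2 : ℝ) ^ (Real.logb 2 (n : ℝ) ^ c₂)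
    swap
    · exact ⟨fun _ => false, fun hn hm => absurd ⟨hn, hm⟩ hpos⟩
    obtain ⟨hn, hm⟩ := hpos
    obtain ⟨h1, h2, h3⟩ := hn₀ n hge
    set D := (Nat.log 2 n + 1) ^ e with hD
    have hDpos : 0 < D := Nat.pow_pos (Nat.succ_pos _)
    set l := productList (helpVectors h) D with hl
    have hlen : l.length = (m + 1) ^ D := by
      rw [hl, length_productList]; simp [helpVectors]
    have hcard : (l.length : ℝ) ≤ 2 ^ (Real.logb 2 (n : ℝ) ^ c₀) := by
      rw [hlen]; exact h1 m hm
    have hexists := exists_isRemote (Nat.two_pow_pos n) l.get (m := l.length)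
      (r := (2 : ℝ) ^ n / (2 : ℝ) ^ (Real.logb 2 (n : ℝ) ^ c₁))
      (by
        have : (4 : ℝ) * l.length ≤ 2 ^ n := by linarith
        exact_mod_cast this)
      (by simpa using h3)
    obtain ⟨v, hv, hout⟩ := hp n hn l.length hcard l.get hexists
    have hrange : Set.range l.get = {q | q ∈ l} := Set.range_list_get l
    rw [hrange] at hv
    rw [show (List.ofFn fun i => vecBits (l.get i)).flatten = StackProg.listBits l by
      rw [StackProg.listBits]
      congr 1
      exact (List.map_ofFn (f := l.get) (g := vecBits)).symm.trans (by rw [List.ofFn_get])] at hout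
    refine ⟨fun y => decide (v (cubeIndex y) = 1), fun _ _ => ⟨fun y => ?_,
      fun _ => ⟨v, hv, rfl⟩⟩⟩
    have hprod : (m + 1) ^ D * 2 ^ n ≤ 2 ^ (A * n ^ A + A) := by
      have h4 : (m + 1) ^ D ≤ 2 ^ n ^ b := by
        rw [← hlen]; exact_mod_cast hcard.trans (hb n hn)
      refine (Nat.mul_le_mul_right _ h4).trans ?_
      rw [← pow_add]
      refine Nat.pow_le_pow_right two_pos ?_
      have h5 : n ^ b ≤ n ^ A := Nat.pow_le_pow_right hn (by omega)
      have h6 : n ≤ n ^ A := Nat.le_self_pow (by omega) n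
      have h7 : 2 * n ^ A ≤ A * n ^ A := Nat.mul_le_mul_right _ (by omega)
      omega
    have hmQ : m * 2 ^ n ≤ 2 ^ (A * n ^ A + A) := by
      refine (Nat.mul_le_mul_right _ ?_).trans hprod
      exact (Nat.le_succ m).trans (Nat.le_self_pow hDpos.ne' _)
    have heQ : D ≤ 2 ^ (A * n ^ A + A) := by
      have h4 : Nat.log 2 n + 1 ≤ 2 ^ n :=
        (Nat.succ_le_of_lt (Nat.log_lt_of_lt_pow hn.ne' Nat.lt_two_pow_self)).trans
          Nat.lt_two_pow_self.le
      refine (Nat.pow_le_pow_left h4 e).trans ?_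
      rw [← pow_mul]
      refine Nat.pow_le_pow_right two_pos ?_
      have h6 : n ≤ n ^ A := Nat.le_self_pow (by omega) n
      calc n * e ≤ n ^ A * A := Nat.mul_le_mul h6 (by omega)
        _ ≤ _ := by rw [mul_comm]; exact Nat.le_add_right _ _
    have hpQ : 2 ^ (a * n ^ a + a) ≤ 2 ^ (A * n ^ A + A) :=
      Nat.pow_le_pow_right two_pos (Nat.add_le_add (Nat.mul_le_mul (by omega)
        (Nat.pow_le_pow_right hn (by omega))) (by omega))
    exact (StackProg.outputsWithin_remoteFunction_of_le h y hge hn v (hsize n hn) hmQ heQ hprod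
      (hout.mono hpQ)).mono (ha' n hn)
  choose g hg using hmain
  refine ⟨g, ⟨_, a', fun n hn m hm h y => (hg n m h hn hm).1 y⟩, fun c => ?_⟩
  filter_upwards [eventually_exists_degree (hlarge.trans_lt hc₁) hde c, eventually_ge_atTop n₀,
    eventually_gt_atTop 0] with n hdeg hge hn m hm h
  obtain ⟨l, hl, hld, herr⟩ := hdeg
  obtain ⟨v, hv, hG⟩ := (hg n m h hn hm).2 hge
  rw [hG]
  refine not_mem_sizeDepth_of_isRemote h hl ?_
    ((helpSpan_pow_mono _ hld).trans (helpSpan_pow_le_span_productList _ _)) hv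
  have hpos : (0 : ℝ) < 2 ^ (Real.logb 2 (n : ℝ) ^ c₁) := Real.rpow_pos_of_pos two_pos _
  rw [div_mul_eq_mul_div, lt_div_iff₀ hpos, mul_right_comm, mul_comm]
  exact mul_lt_mul_of_pos_left herr (by positivity)
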